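/- **Setting.** Let $N\ge 2$, $n\ge 1$, and let $Y_j=f_*(X_j)+\xi_j$, $j=1,\dots,n$, where $X,X_1,\dots,X_n$ are i.i.d. with distribution $\Pi$ on a measurable space $S$, and $\xi,\xi_1,\dots,\xi_n$ are i.i.d. real random variables with $\mathbb E\xi=0$, such that $(\xi_1,\dots,\xi_n)$ is independent of $(X_1,\dots,X_n)$ and $\xi$ is independent of $X$. Let $h_1,\dots,h_N\in L_2(\Pi)$ and $f_*:S\to\mathbb R$ be measurable, and put $f_\lambda=\sum_j\lambda_jh_j$ for $\lambda\in\mathbb R^N$, $J_\lambda=\{j:\lambda_j\ne0\}$, $d(J)=\mathrm{card}(J)$, $d(\lambda)=d(J_\lambda)$. For $\varepsilon>0$ let $$\hat\Lambda_\varepsilon=\Big\{\lambda\in\mathbb R^N:\max_{1\le k\le N}\Big|\frac1n\sum_{j=1}^n(f_\lambda(X_j)-Y_j)h_k(X_j)\Big|\le\varepsilon\Big\},$$ and let the Dantzig selector $\hat\lambda$ be any element of $\hat\Lambda_\varepsilon$ of minimal $\ell_1$-norm (an arbitrary vector if $\hat\Lambda_\varepsilon=\emptyset$). Let $\|\eta\|_{\psi_1}=\inf\{c>0:\mathbb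 E(e^{|\eta|/c}-1)\le1\}$ (with $\inf\emptyset=\infty$), and write $\|f\|_{\psi_1}=\|f(X)\|_{\psi_1}$ for $f:S\to\mathbb R$. For $J\subset\{1,\dots,N\}$ let $C_J=\{u\in\mathbb R^N:\sum_{j\notin J}|u_j|\le\sum_{j\in J}|u_j|\}$ and $$\beta_2(J)=\inf\Big\{\beta>0:\ \sum_{j\in J}|u_j|^2\le\beta^2\|f_u\|_{L_2(\Pi)}^2\ \text{ for all }u\in C_J\Big\}\in[0,\infty].$$ Suppose that $B(J)>0$, $J\subset\{1,\dots,N\}$, are constants such that $$\|f_u\|_{L_1(\Pi)}\le\|f_u\|_{L_2(\Pi)}\le B(J)\|f_u\|_{L_1(\Pi)}\qquad\text{for all }u\in C_J .\tag{2.2}$$ Put $\beta_2(d)=\max\{\beta_2(J):d(J)\le 2d\}$, $B(d)=\max\{B(J):d(J)\le d\}$ and $\binom{N}{\le k}=\sum_{j=0}^k\binom Nj$. For $A\ge1$ with $\frac{A\log N}{n}\le1$ and a constant $C>0$, let $\bar d$ be the largest integer $d$ with $0\le d\le\frac Ne-1$ (assumed to exist, as it does for all $N\ge3$) such that $$\frac{Ad\log(N/d)}{n}\le1\quad\text{and}\quad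 CB(d)\beta_2(d)\sup_{\|u\|_{\ell_2}\le1,\,d(u)\le d}\|f_u\|_{\psi_1}\sqrt{\frac{Ad\log(N/d)}{n}}\le\frac14,$$ where $d\log(N/d)$ is $0$ for $d=0$ (and $0\cdot\infty=0$). Let $$\Lambda_\varepsilon(A)=\Big\{\lambda:\ |\langle f_\lambda-f_*,h_k\rangle_{L_2(\Pi)}|+C\big(\|(f_\lambda-f_*)(X)h_k(X)\|_{\psi_1}+\|\xi h_k(X)\|_{\psi_1}\big)\sqrt{\tfrac{A\log N}{n}}\le\varepsilon,\ k=1,\dots,N\Big\}$$ and $\tilde\Lambda^2_\varepsilon(A)=\Lambda_\varepsilon(A)\cap\{\lambda:d(\lambda)\le\bar d\}$. **Theorem 2.** There is a numerical constant $C>0$ in the definitions of $\Lambda_\varepsilon(A)$ and $\bar d$ such that, in the above setting and under (2.2), the following holds for all $A\ge1$. With probability at least $1-5^{-\bar dA}\binom{N}{\le\bar d}^{-A}$, every $\lambda\in\hat\Lambda_\varepsilon$ with $d(\lambda)\le\bar d$ satisfies $$\|f_{\hat\lambda}-f_\lambda\|_{L_2(\Pi)}\le16B^2(d(\lambda))\,\beta_2(d(\lambda))\sqrt{d(\lambda)}\,\varepsilon\quad\text{and}\quad\|\hat\lambda-\lambda\|_{\ell_2}\le32B^2(d(\lambda))\,\beta_2^2(d(\lambda))\sqrt{d(\lambda)}\,\varepsilon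 .$$ If $\tilde\Lambda^2_\varepsilon(A)\ne\emptyset$, then with probability at least $1-N^{-A}$, $$\|f_{\hat\lambda}-f_*\|_{L_2(\Pi)}\le\inf_{\lambda\in\tilde\Lambda^2_\varepsilon(A)}\Big[\|f_\lambda-f_*\|_{L_2(\Pi)}+16B^2(d(\lambda))\,\beta_2(d(\lambda))\sqrt{d(\lambda)}\,\varepsilon\Big],$$ and if, in addition, $f_*=f_{\lambda^*}$ ($\Pi$-a.e.) for some $\lambda^*\in\mathbb R^N$, then, also with probability at least $1-N^{-A}$, $$\|\hat\lambda-\lambda^*\|_{\ell_2}\le\inf_{\lambda\in\tilde\Lambda^2_\varepsilon(A)}\Big[\|\lambda-\lambda^*\|_{\ell_2}+32B^2(d(\lambda))\,\beta_2^2(d(\lambda))\sqrt{d(\lambda)}\,\varepsilon\Big].$$ -/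

import Mathlib

open MeasureTheory ProbabilityTheory
open scoped ENNReal NNReal

noncomputable section

namespace Dantzig

/-- The Orlicz norm `inf {c > 0 : E ψ(|η| / c) ≤ 1}` of `η` under `μ` (it is `∞` if there is
no such `c`). -/
def orliczNorm {α : Type*} [MeasurableSpace α] (ψ : ℝ → ℝ) (μ : Measure α) (η : α → ℝ) : ℝ≥0∞ :=
  ⨅ (c : ℝ) (_ : 0 < c ∧ ∫⁻ a, ENNReal.ofReal (ψ (|η a| / c)) ∂μ ≤ 1), ENNReal.ofReal c

/-- `ψ₁(x) = e^{|x|} - 1`. -/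
def psiOne (x : ℝ) : ℝ := Real.exp |x| - 1

/-- `‖η‖_{ψ₁}` for a random variable `η` on the probability space `(α, μ)`. -/
def psiOneNorm {α : Type*} [MeasurableSpace α] (μ : Measure α) (η : α → ℝ) : ℝ≥0∞ :=
  orliczNorm psiOne μ η

section Dictionary

variable {S : Type*} {N n : ℕ}

/-- `f_u = ∑ⱼ uⱼ hⱼ`. -/
def lin (h : Fin N → S → ℝ) (u : EuclideanSpace ℝ (Fin N)) : S → ℝ :=
  fun x => ∑ j, u j * h j x

/-- `J_u = supp(u)`. -/
def supp (u : EuclideanSpace ℝ (Fin N)) : Finset (Fin N) := {j | u j ≠ 0}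

/-- `d(u) = card(J_u)`. -/
def dim (u : EuclideanSpace ℝ (Fin N)) : ℕ := (supp u).card

/-- The `ℓ₁`-norm of the vector `u`. -/
def l1norm (u : EuclideanSpace ℝ (Fin N)) : ℝ := ∑ j, |u j|

/-- The cone `C_J` of vectors whose coordinates in `J` are dominant. -/
def cone (J : Finset (Fin N)) : Set (EuclideanSpace ℝ (Fin N)) :=
  {u | ∑ j ∈ Jᶜ, |u j| ≤ ∑ j ∈ J, |u j|}

/-- The set of constraints of the Dantzig selector, for the data `(x₁, y₁), …, (xₙ, yₙ)`. -/
def feasible (h : Fin N → S → ℝ) (ε : ℝ) (x : Fin n → S) (y : Fin n → ℝ) :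
    Set (EuclideanSpace ℝ (Fin N)) :=
  {u | ∀ k, |(n : ℝ)⁻¹ * ∑ j, (lin h u (x j) - y j) * h k (x j)| ≤ ε}

/-- The set of minimizers of the `ℓ₁`-norm over the set `K`. -/
def argminL1 (K : Set (EuclideanSpace ℝ (Fin N))) : Set (EuclideanSpace ℝ (Fin N)) :=
  {u | u ∈ K ∧ ∀ v ∈ K, l1norm u ≤ l1norm v}

/-- `B(d) = max {B(J) : d(J) ≤ d}`. -/
def maxB (B : Finset (Fin N) → ℝ≥0) (d : ℕ) : ℝ≥0 :=
  (Finset.univ.filter fun J : Finset (Fin N) => J.card ≤ d).sup B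

variable [MeasurableSpace S]

/-- Equivalence of the `L₁(Q)`- and `L₂(Q)`-norms on the cones `C_J`, with constants `B(J) > 0`. -/
def NormEquiv (h : Fin N → S → ℝ) (Q : Measure S) (B : Finset (Fin N) → ℝ≥0) : Prop :=
  ∀ J, 0 < B J ∧ ∀ u ∈ cone J,
    eLpNorm (lin h u) 1 Q ≤ eLpNorm (lin h u) 2 Q ∧
    eLpNorm (lin h u) 2 Q ≤ B J * eLpNorm (lin h u) 1 Q

/-- `β₂(J)`, which is `∞` if no `β` has the required property. -/
def betaTwo (h : Fin N → S → ℝ) (Q : Measure S) (J : Finset (Fin N)) : ℝ≥0∞ :=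
  ⨅ (β : ℝ≥0) (_ : 0 < β ∧ ∀ u ∈ cone J,
    ENNReal.ofReal (∑ j ∈ J, |u j| ^ 2) ≤ (β : ℝ≥0∞) ^ 2 * eLpNorm (lin h u) 2 Q ^ 2),
    (β : ℝ≥0∞)

/-- `β₂(d) = max {β₂(J) : d(J) ≤ 2d}`. -/
def maxBetaTwo (h : Fin N → S → ℝ) (Q : Measure S) (d : ℕ) : ℝ≥0∞ :=
  ⨆ (J : Finset (Fin N)) (_ : J.card ≤ 2 * d), betaTwo h Q J

/-- The supremum of `‖f_u‖_{ψ₁}` over the vectors `u` with `‖u‖_{ℓ₂} ≤ 1` and `d(u) ≤ d`. -/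
def sparsePsiOne (h : Fin N → S → ℝ) (Q : Measure S) (d : ℕ) : ℝ≥0∞ :=
  ⨆ (u : EuclideanSpace ℝ (Fin N)) (_ : ‖u‖ ≤ 1 ∧ dim u ≤ d), psiOneNorm Q (lin h u)

/-- The vectors `u` for which `f_u` approximates `fstar` well; `Q` is the distribution of `X`, and
`ν` is that of the noise `ξ`, which is independent of `X`. -/
def approxSet (h : Fin N → S → ℝ) (fstar : S → ℝ) (Q : Measure S) (ν : Measure ℝ) (n : ℕ)
    (C A ε : ℝ) : Set (EuclideanSpace ℝ (Fin N)) :=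
  {u | ∀ k,
    ENNReal.ofReal |∫ x, (lin h u x - fstar x) * h k x ∂Q| +
      ENNReal.ofReal C *
        (psiOneNorm Q (fun x => (lin h u x - fstar x) * h k x) +
          psiOneNorm (Q.prod ν) (fun p => p.2 * h k p.1)) *
        ENNReal.ofReal √(A * Real.log N / n) ≤ ENNReal.ofReal ε}

/-- The integers `d` of which `d̄` is the largest (for `d = 0`, the expression `d log(N/d)` is
read as `0`). -/
def admissible (h : Fin N → S → ℝ) (Q : Measure S) (B : Finset (Fin N) → ℝ≥0) (n : ℕ)
    (C A : ℝ) : Set ℕ :=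
  {d | (d : ℝ) ≤ N / Real.exp 1 - 1 ∧
    A * d * Real.log (N / d) / n ≤ 1 ∧
    ENNReal.ofReal C * maxB B d * maxBetaTwo h Q d * sparsePsiOne h Q d *
      ENNReal.ofReal √(A * d * Real.log (N / d) / n) ≤ 1 / 4}

/-- The set of oracle vectors: those of `approxSet` with `d(u) ≤ dbar`. -/
def oracleSet (h : Fin N → S → ℝ) (fstar : S → ℝ) (Q : Measure S) (ν : Measure ℝ) (n : ℕ)
    (C A ε : ℝ) (dbar : ℕ) : Set (EuclideanSpace ℝ (Fin N)) :=
  approxSet h fstar Q ν n C A ε ∩ {u | dim u ≤ dbar}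

/-- `16 B²(d) β₂(d) √d ε`. -/
def boundL2 (h : Fin N → S → ℝ) (Q : Measure S) (B : Finset (Fin N) → ℝ≥0) (ε : ℝ) (d : ℕ) :
    ℝ≥0∞ :=
  16 * (maxB B d : ℝ≥0∞) ^ 2 * maxBetaTwo h Q d * ENNReal.ofReal √(d : ℝ) * ENNReal.ofReal ε

/-- `32 B²(d) β₂²(d) √d ε`. -/
def boundEll2 (h : Fin N → S → ℝ) (Q : Measure S) (B : Finset (Fin N) → ℝ≥0) (ε : ℝ) (d : ℕ) :
    ℝ≥0∞ :=
  32 * (maxB B d : ℝ≥0∞) ^ 2 * maxBetaTwo h Q d ^ 2 * ENNReal.ofReal √(d : ℝ) * ENNReal.ofReal ε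

end Dictionary

/-- The number `∑_{j ≤ k} (N choose j)` of subsets of cardinality at most `k`. -/
def chooseLE (N k : ℕ) : ℕ := ∑ j ∈ Finset.range (k + 1), N.choose j

/-- The property `E` holds with probability at least `p` (it need not be measurable: it is
required to hold on an event of probability at least `p`). -/
def HoldsWithProb {Ω : Type*} [MeasurableSpace Ω] (P : Measure Ω) (p : ℝ) (E : Ω → Prop) : Prop :=
  ∃ G : Set Ω, MeasurableSet G ∧ ENNReal.ofReal p ≤ P G ∧ ∀ ω ∈ G, E ω

end Dantzig

end

/-!
Let `u = λ̂ - λ` for a feasible `λ` with support `J`, `d = card J`. Since `λ̂` has minimal `ℓ₁`-norm,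
`u` lies in the cone `C_J`, and since both vectors are feasible, the empirical `L₂`-norm of `f_u`
satisfies `‖f_u‖²_{L₂(Πₙ)} ≤ 2ε‖u‖₁ ≤ 4ε√d ‖u_J‖₂ ≤ 4ε√d β₂(d) ‖f_u‖_{L₂(Π)}`. If the empirical
`L₁`-norm of `f_u` is not much smaller than the true one, then
`‖f_u‖_{L₂(Π)} ≤ B ‖f_u‖_{L₁(Π)} ≤ 2B ‖f_u‖_{L₂(Πₙ)}`, and the two inequalities together give the
bounds (`bounds_of_lower_deviation`). Only the lower deviations of the empirical `L₁`-norm matter.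

By the shelling argument (`exists_superset_of_mem_cone`) `u` lies in the closed convex hull of the
`d`-sparse unit vectors, scaled by `3β₂(d)‖f_u‖_{L₂(Π)}`, so it suffices to bound
`∑ⱼ (E|f_u(X)| - |f_u(Xⱼ)|)` uniformly over this hull. The map `u ↦ |f_u|` is not linear, so the
supremum does not pass to the extreme points directly. Its exponential moment is symmetrized one
observation at a time (`lintegral_iSup_exp_le`): the arithmetic-geometric mean inequality separates
the two copies of the observation and leaves a random sign, and for the absolute value the
contraction principle is the elementary remark `-|z| ≤ ±z` (`iSup_exp_abs_add_le`). What is left is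
the supremum of a linear functional, which is attained up to a factor of two on a net of at most
`5^d (N choose ≤ d)` sparse vectors; this is `lintegral_pi_iSup_exp_le`. For `d ≤ N/e` the entropy
of the net is at most `4 d log(N/d)`, which the exponent in Markov's inequality absorbs.

For the oracle inequalities, a fixed `λ` in the oracle set is feasible with large probability by
Bernstein's inequality (`measure_not_feasible_le`), and then the triangle inequality applies. The
exceptional event depends on `λ`; along a sequence minimizing the right-hand side these events
increase, so the infimum costs nothing in probability (`measure_not_le_iInf_le`).
-/

namespace Dantzig

/-! ### The `ψ₁`-norm and exponential moments -/

section Orlicz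

variable {α : Type*} [MeasurableSpace α] {μ : Measure α}

theorem measurable_psiOne : Measurable psiOne := by
  unfold psiOne; fun_prop

theorem psiOne_nonneg (x : ℝ) : 0 ≤ psiOne x := by
  unfold psiOne; linarith [Real.one_le_exp (abs_nonneg x)]

theorem psiOne_mono {x y : ℝ} (h : |x| ≤ |y|) : psiOne x ≤ psiOne y := by
  unfold psiOne; linarith [Real.exp_le_exp.2 h]

theorem exists_of_psiOneNorm_lt {Z : α → ℝ} {a : ℝ≥0∞} (h : psiOneNorm μ Z < a) :
    ∃ c : ℝ, 0 < c ∧ ∫⁻ x, ENNReal.ofReal (psiOne (|Z x| / c)) ∂μ ≤ 1 ∧ ENNReal.ofReal c < a := by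
  unfold psiOneNorm orliczNorm at h
  simp only [iInf_lt_iff] at h
  obtain ⟨c, ⟨hc, hb⟩, hlt⟩ := h
  exact ⟨c, hc, hb, hlt⟩

theorem lintegral_psiOne_le_one {Z : α → ℝ} {c : ℝ} (h : psiOneNorm μ Z < ENNReal.ofReal c) :
    0 < c ∧ ∫⁻ x, ENNReal.ofReal (psiOne (|Z x| / c)) ∂μ ≤ 1 := by
  obtain ⟨c', hc', hb, hlt⟩ := exists_of_psiOneNorm_lt h
  have hcc : c' < c := (ENNReal.ofReal_lt_ofReal_iff_of_nonneg hc'.le).1 hlt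
  refine ⟨hc'.trans hcc, le_trans (lintegral_mono fun x => ?_) hb⟩
  refine ENNReal.ofReal_le_ofReal (psiOne_mono ?_)
  rw [abs_div, abs_div, abs_of_pos hc', abs_of_pos (hc'.trans hcc)]
  gcongr

theorem psiOneNorm_le {Z : α → ℝ} {c : ℝ} (hc : 0 < c)
    (h : ∫⁻ x, ENNReal.ofReal (psiOne (|Z x| / c)) ∂μ ≤ 1) :
    psiOneNorm μ Z ≤ ENNReal.ofReal c := by
  unfold psiOneNorm orliczNorm
  exact iInf₂_le c ⟨hc, h⟩

/-- Convexity of `exp`: `psiOne` of a sum is at most the corresponding convex combination. -/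
theorem psiOne_add_div_le {a b c d : ℝ} (hc : 0 < c) (hd : 0 < d) :
    psiOne (|a + b| / (c + d)) ≤
      c / (c + d) * psiOne (|a| / c) + d / (c + d) * psiOne (|b| / d) := by
  have hcd : 0 < c + d := by positivity
  have h1 : |(|a + b| / (c + d))| ≤ c / (c + d) * (|a| / c) + d / (c + d) * (|b| / d) := by
    rw [abs_of_nonneg (by positivity)]
    have : c / (c + d) * (|a| / c) + d / (c + d) * (|b| / d) = (|a| + |b|) / (c + d) := by
      field_simp
    rw [this]
    gcongr
    exact abs_add_le a b
  have h2 := convexOn_exp.2 (Set.mem_univ (|a| / c)) (Set.mem_univ (|b| / d))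
    (by positivity : 0 ≤ c / (c + d)) (by positivity : 0 ≤ d / (c + d))
    (by rw [← add_div, div_self hcd.ne'])
  simp only [smul_eq_mul] at h2
  have h3 := Real.exp_le_exp.2 h1
  unfold psiOne
  rw [abs_of_nonneg (by positivity : 0 ≤ |a| / c), abs_of_nonneg (by positivity : 0 ≤ |b| / d)]
  have h4 : c / (c + d) + d / (c + d) = 1 := by rw [← add_div, div_self hcd.ne']
  nlinarith

theorem psiOneNorm_add_le {Z W : α → ℝ} (hZ : Measurable Z) :
    psiOneNorm μ (Z + W) ≤ psiOneNorm μ Z + psiOneNorm μ W := by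
  refine ENNReal.le_of_forall_pos_le_add fun e he hfin => ?_
  have hZf : psiOneNorm μ Z ≠ ∞ := (lt_of_le_of_lt le_self_add hfin).ne
  have hWf : psiOneNorm μ W ≠ ∞ := (lt_of_le_of_lt le_add_self hfin).ne
  have he2 : ((e / 2 : ℝ≥0) : ℝ≥0∞) ≠ 0 := by
    rw [ENNReal.coe_ne_zero]; positivity
  obtain ⟨c, hc, hcb, hcl⟩ := exists_of_psiOneNorm_lt (ENNReal.lt_add_right hZf he2)
  obtain ⟨d, hd, hdb, hdl⟩ := exists_of_psiOneNorm_lt (ENNReal.lt_add_right hWf he2)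
  have hcd : 0 < c + d := by positivity
  have key : ∫⁻ x, ENNReal.ofReal (psiOne (|(Z + W) x| / (c + d))) ∂μ ≤ 1 := by
    calc ∫⁻ x, ENNReal.ofReal (psiOne (|(Z + W) x| / (c + d))) ∂μ
        ≤ ∫⁻ x, (ENNReal.ofReal (c / (c + d)) * ENNReal.ofReal (psiOne (|Z x| / c)) +
            ENNReal.ofReal (d / (c + d)) * ENNReal.ofReal (psiOne (|W x| / d))) ∂μ := by
          refine lintegral_mono fun x => ?_
          rw [← ENNReal.ofReal_mul (by positivity), ← ENNReal.ofReal_mul (by positivity),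
            ← ENNReal.ofReal_add (mul_nonneg (by positivity) (psiOne_nonneg _))
              (mul_nonneg (by positivity) (psiOne_nonneg _))]
          exact ENNReal.ofReal_le_ofReal (psiOne_add_div_le hc hd)
      _ = ENNReal.ofReal (c / (c + d)) * ∫⁻ x, ENNReal.ofReal (psiOne (|Z x| / c)) ∂μ +
            ENNReal.ofReal (d / (c + d)) * ∫⁻ x, ENNReal.ofReal (psiOne (|W x| / d)) ∂μ := by
          have hm : Measurable fun x => ENNReal.ofReal (psiOne (|Z x| / c)) :=
            (measurable_psiOne.comp (by fun_prop)).ennreal_ofReal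
          rw [lintegral_add_left (hm.const_mul _), lintegral_const_mul _ hm,
            lintegral_const_mul' _ _ ENNReal.ofReal_ne_top]
      _ ≤ ENNReal.ofReal (c / (c + d)) * 1 + ENNReal.ofReal (d / (c + d)) * 1 := by gcongr
      _ = 1 := by
          rw [mul_one, mul_one, ← ENNReal.ofReal_add (by positivity) (by positivity), ← add_div,
            div_self hcd.ne', ENNReal.ofReal_one]
  calc psiOneNorm μ (Z + W) ≤ ENNReal.ofReal (c + d) := psiOneNorm_le hcd key
    _ = ENNReal.ofReal c + ENNReal.ofReal d := ENNReal.ofReal_add hc.le hd.le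
    _ ≤ (psiOneNorm μ Z + ((e / 2 : ℝ≥0) : ℝ≥0∞)) + (psiOneNorm μ W + ((e / 2 : ℝ≥0) : ℝ≥0∞)) :=
        add_le_add hcl.le hdl.le
    _ = psiOneNorm μ Z + psiOneNorm μ W + e := by
        rw [add_add_add_comm, ← ENNReal.coe_add, add_halves]

theorem psiOneNorm_neg (Z : α → ℝ) : psiOneNorm μ (-Z) = psiOneNorm μ Z := by
  simp [psiOneNorm, orliczNorm]

/-- The `L₁`-norm is dominated by the `ψ₁`-norm, since `y ≤ e^y - 1`. -/
theorem lintegral_enorm_le_psiOneNorm (Z : α → ℝ) : ∫⁻ x, ‖Z x‖ₑ ∂μ ≤ psiOneNorm μ Z := by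
  unfold psiOneNorm orliczNorm
  refine le_iInf₂ fun c hc => ?_
  calc ∫⁻ x, ‖Z x‖ₑ ∂μ ≤ ∫⁻ x, ENNReal.ofReal c * ENNReal.ofReal (psiOne (|Z x| / c)) ∂μ := by
        refine lintegral_mono fun x => ?_
        rw [← ENNReal.ofReal_mul hc.1.le, ← ofReal_norm]
        refine ENNReal.ofReal_le_ofReal ?_
        have h0 : 0 ≤ |Z x| / c := div_nonneg (abs_nonneg _) hc.1.le
        have h1 := Real.add_one_le_exp (|Z x| / c)
        have h2 : |Z x| / c ≤ psiOne (|Z x| / c) := by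
          unfold psiOne; rw [abs_of_nonneg h0]; linarith
        calc ‖Z x‖ = c * (|Z x| / c) := by
              rw [mul_div_cancel₀ _ hc.1.ne', Real.norm_eq_abs]
          _ ≤ _ := by gcongr; exact hc.1.le
    _ = ENNReal.ofReal c * ∫⁻ x, ENNReal.ofReal (psiOne (|Z x| / c)) ∂μ :=
        lintegral_const_mul' _ _ ENNReal.ofReal_ne_top
    _ ≤ ENNReal.ofReal c * 1 := by gcongr; exact hc.2
    _ = ENNReal.ofReal c := mul_one _

theorem integrable_of_psiOneNorm_ne_top {Z : α → ℝ} (hZ : Measurable Z)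
    (h : psiOneNorm μ Z ≠ ∞) : Integrable Z μ :=
  ⟨hZ.aestronglyMeasurable, lt_of_le_of_lt (lintegral_enorm_le_psiOneNorm Z) h.lt_top⟩

theorem ae_eq_zero_of_psiOneNorm_eq_zero {Z : α → ℝ} (hZ : Measurable Z)
    (h : psiOneNorm μ Z = 0) : Z =ᵐ[μ] 0 := by
  have h1 : ∫⁻ x, ‖Z x‖ₑ ∂μ = 0 := le_antisymm (h ▸ lintegral_enorm_le_psiOneNorm Z) zero_le
  rw [lintegral_eq_zero_iff hZ.enorm] at h1
  filter_upwards [h1] with x hx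
  simpa using hx

/-- `e^{θy} - 1 - θy ≤ θ² (e^y - 1 - y)` for `θ ∈ [0, 1]` and `y ≥ 0`, by comparison of the power
series. -/
theorem exp_mul_sub_le {θ y : ℝ} (h0 : 0 ≤ θ) (h1 : θ ≤ 1) (hy : 0 ≤ y) :
    Real.exp (θ * y) - 1 - θ * y ≤ θ ^ 2 * (Real.exp y - 1 - y) := by
  have hs : ∀ x : ℝ, HasSum (fun k : ℕ => x ^ k / (k.factorial : ℝ)) (Real.exp x) := fun x => by
    rw [Real.exp_eq_exp_ℝ]; exact NormedSpace.expSeries_div_hasSum_exp x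
  have hl := hs (θ * y)
  have hr := (((hs y).mul_left (θ ^ 2)).add (hasSum_ite_eq (0 : ℕ) (1 - θ ^ 2))).add
    (hasSum_ite_eq (1 : ℕ) (θ * y - θ ^ 2 * y))
  have := hasSum_le (fun k => ?_) hl hr
  · linarith
  · rcases k with _ | _ | k
    · simp
    · simp
    · simp only [mul_pow]
      have hk : θ ^ (k + 1 + 1) ≤ θ ^ 2 := pow_le_pow_of_le_one h0 h1 (by omega)
      have hp : 0 ≤ y ^ (k + 1 + 1) / ((k + 1 + 1).factorial : ℝ) := by positivity
      simp
      rw [mul_div_assoc]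
      exact mul_le_mul_of_nonneg_right hk hp

/-- The pointwise form of Bernstein's moment bound. -/
theorem exp_mul_le {s c z : ℝ} (hc : 0 < c) (hs : |s| * c ≤ 1) :
    Real.exp (s * z) ≤ 1 + s * z + (s * c) ^ 2 * psiOne (|z| / c) := by
  have hy : 0 ≤ |z| / c := by positivity
  have key := exp_mul_sub_le (by positivity : 0 ≤ |s| * c) hs hy
  have he : |s| * c * (|z| / c) = |s * z| := by rw [abs_mul]; field_simp
  rw [he] at key
  have h1 : Real.exp (s * z) - s * z ≤ Real.exp |s * z| - |s * z| := by
    rcases le_total 0 (s * z) with h | h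
    · rw [abs_of_nonneg h]
    · rw [abs_of_nonpos h]
      have := Real.self_le_sinh_iff.2 (neg_nonneg.2 h)
      rw [Real.sinh_eq, neg_neg] at this
      linarith
  have h2 : (|s| * c) ^ 2 = (s * c) ^ 2 := by rw [mul_pow, mul_pow, sq_abs]
  have h3 : Real.exp (|z| / c) - 1 - |z| / c ≤ psiOne (|z| / c) := by
    unfold psiOne; rw [abs_of_nonneg hy]; linarith
  have h4 := mul_le_mul_of_nonneg_left h3 (sq_nonneg (s * c))
  rw [h2] at key
  linarith

/-- Bernstein's moment bound for a variable of `ψ₁`-norm at most `c`, not necessarily centered. -/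
theorem lintegral_exp_mul_le [IsProbabilityMeasure μ] {Z : α → ℝ} (hZ : Measurable Z)
    (hZi : Integrable Z μ) {s c : ℝ} (hc : 0 < c)
    (hb : ∫⁻ x, ENNReal.ofReal (psiOne (|Z x| / c)) ∂μ ≤ 1) (hs : |s| * c ≤ 1) :
    ∫⁻ x, ENNReal.ofReal (Real.exp (s * Z x)) ∂μ ≤
      ENNReal.ofReal (Real.exp (s * (∫ x, Z x ∂μ) + (s * c) ^ 2)) := by
  have hm : Measurable fun x => psiOne (|Z x| / c) := measurable_psiOne.comp (by fun_prop)
  have hpi : Integrable (fun x => psiOne (|Z x| / c)) μ := by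
    refine ⟨hm.aestronglyMeasurable, ?_⟩
    rw [hasFiniteIntegral_iff_ofReal (Filter.Eventually.of_forall fun x => psiOne_nonneg _)]
    exact lt_of_le_of_lt hb ENNReal.one_lt_top
  have hp1 : ∫ x, psiOne (|Z x| / c) ∂μ ≤ 1 := by
    rw [integral_eq_lintegral_of_nonneg_ae (Filter.Eventually.of_forall fun x => psiOne_nonneg _)
      hm.aestronglyMeasurable]
    exact ENNReal.toReal_le_of_le_ofReal zero_le_one (by simpa using hb)
  have hgi : Integrable (fun x => 1 + s * Z x + (s * c) ^ 2 * psiOne (|Z x| / c)) μ :=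
    ((integrable_const _).add (hZi.const_mul s)).add (hpi.const_mul _)
  have hle : ∀ x, Real.exp (s * Z x) ≤ 1 + s * Z x + (s * c) ^ 2 * psiOne (|Z x| / c) :=
    fun x => exp_mul_le hc hs
  calc ∫⁻ x, ENNReal.ofReal (Real.exp (s * Z x)) ∂μ
      ≤ ∫⁻ x, ENNReal.ofReal (1 + s * Z x + (s * c) ^ 2 * psiOne (|Z x| / c)) ∂μ :=
        lintegral_mono fun x => ENNReal.ofReal_le_ofReal (hle x)
    _ = ENNReal.ofReal (∫ x, (1 + s * Z x + (s * c) ^ 2 * psiOne (|Z x| / c)) ∂μ) :=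
        (ofReal_integral_eq_lintegral_ofReal hgi
          (Filter.Eventually.of_forall fun x => (Real.exp_pos _).le.trans (hle x))).symm
    _ ≤ _ := by
        refine ENNReal.ofReal_le_ofReal ?_
        have hi1 : Integrable (fun x => 1 + s * Z x) μ := (integrable_const _).add (hZi.const_mul s)
        rw [integral_add hi1 (hpi.const_mul _),
          integral_add (integrable_const _) (hZi.const_mul s), integral_const_mul,
          integral_const_mul]
        simp only [integral_const, probReal_univ, smul_eq_mul, mul_one]
        have h1 := Real.add_one_le_exp (s * (∫ x, Z x ∂μ) + (s * c) ^ 2)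
        have h2 := mul_le_mul_of_nonneg_left hp1 (sq_nonneg (s * c))
        linarith

/-- Bernstein's moment bound for a variable multiplied by an independent random sign. -/
theorem lintegral_cosh_mul_le [IsProbabilityMeasure μ] {Z : α → ℝ} {s c : ℝ} (hc : 0 < c)
    (hb : ∫⁻ x, ENNReal.ofReal (psiOne (|Z x| / c)) ∂μ ≤ 1) (hs : |s| * c ≤ 1) :
    ∫⁻ x, ENNReal.ofReal (Real.cosh (s * Z x)) ∂μ ≤ ENNReal.ofReal (Real.exp ((s * c) ^ 2)) := by
  have hle : ∀ x, Real.cosh (s * Z x) ≤ 1 + (s * c) ^ 2 * psiOne (|Z x| / c) := fun x => by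
    have h1 := exp_mul_le (z := Z x) hc hs
    have h2 := exp_mul_le (s := -s) (z := Z x) hc (by rwa [abs_neg])
    rw [neg_mul, neg_mul, neg_sq] at h2
    rw [Real.cosh_eq]
    linarith
  calc ∫⁻ x, ENNReal.ofReal (Real.cosh (s * Z x)) ∂μ
      ≤ ∫⁻ x, (1 + ENNReal.ofReal ((s * c) ^ 2) * ENNReal.ofReal (psiOne (|Z x| / c))) ∂μ := by
        refine lintegral_mono fun x => ?_
        rw [← ENNReal.ofReal_mul (sq_nonneg _), ← ENNReal.ofReal_one,
          ← ENNReal.ofReal_add zero_le_one (mul_nonneg (sq_nonneg _) (psiOne_nonneg _))]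
        exact ENNReal.ofReal_le_ofReal (hle x)
    _ = 1 + ENNReal.ofReal ((s * c) ^ 2) * ∫⁻ x, ENNReal.ofReal (psiOne (|Z x| / c)) ∂μ := by
        rw [lintegral_add_left measurable_const, lintegral_const_mul' _ _ ENNReal.ofReal_ne_top]
        simp
    _ ≤ 1 + ENNReal.ofReal ((s * c) ^ 2) * 1 := by gcongr
    _ = ENNReal.ofReal (1 + (s * c) ^ 2) := by
        rw [mul_one, ENNReal.ofReal_add zero_le_one (sq_nonneg _), ENNReal.ofReal_one]
    _ ≤ _ := ENNReal.ofReal_le_ofReal (by linarith [Real.add_one_le_exp ((s * c) ^ 2)])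

/-- Jensen's inequality for `exp`, with a right-hand side that may be infinite. -/
theorem ofReal_exp_integral_le [IsProbabilityMeasure μ] {g : α → ℝ} (hg : Integrable g μ) :
    ENNReal.ofReal (Real.exp (∫ x, g x ∂μ)) ≤ ∫⁻ x, ENNReal.ofReal (Real.exp (g x)) ∂μ := by
  set m := ∫ x, g x ∂μ with hm
  have hi : Integrable (fun x => Real.exp m * (1 + (g x - m))) μ :=
    ((integrable_const _).add (hg.sub (integrable_const _))).const_mul _
  have h1 : ∫ x, Real.exp m * (1 + (g x - m)) ∂μ = Real.exp m := by
    have hi1 : Integrable (fun x => g x - m) μ := hg.sub (integrable_const _)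
    rw [integral_const_mul, integral_add (integrable_const _) hi1,
      integral_sub hg (integrable_const _)]
    simp [← hm]
  calc ENNReal.ofReal (Real.exp m) = ENNReal.ofReal (∫ x, Real.exp m * (1 + (g x - m)) ∂μ) := by
        rw [h1]
    _ ≤ ∫⁻ x, ENNReal.ofReal (Real.exp m * (1 + (g x - m))) ∂μ := by
        rw [integral_eq_lintegral_pos_part_sub_lintegral_neg_part hi]
        refine (ENNReal.ofReal_le_ofReal (sub_le_self _ ENNReal.toReal_nonneg)).trans ?_
        exact ENNReal.ofReal_toReal_le
    _ ≤ _ := by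
        refine lintegral_mono fun x => ENNReal.ofReal_le_ofReal ?_
        have h2 := Real.add_one_le_exp (g x - m)
        calc Real.exp m * (1 + (g x - m)) ≤ Real.exp m * Real.exp (g x - m) := by
              gcongr; linarith
          _ = Real.exp (g x) := by rw [← Real.exp_add]; ring_nf

end Orlicz

/-! ### Symmetrization and contraction -/

section Symmetrization

variable {S : Type*} [MeasurableSpace S]

/-- The contraction step: the pair of signs in front of `|z|` may be replaced by a pair of signs
in front of `z`. -/
theorem iSup_exp_abs_add_le {ι : Type*} (A z : ι → ℝ) :
    (⨆ i, ENNReal.ofReal (Real.exp (A i + |z i|))) +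
        ⨆ i, ENNReal.ofReal (Real.exp (A i - |z i|)) ≤
      (⨆ i, ENNReal.ofReal (Real.exp (A i + z i))) +
        ⨆ i, ENNReal.ofReal (Real.exp (A i - z i)) := by
  rcases isEmpty_or_nonempty ι with hι | hι
  · simp
  refine ENNReal.iSup_add_iSup_le fun i j => ?_
  have hp : ∀ {x : ℝ} (k : ι), x ≤ A k + z k → ENNReal.ofReal (Real.exp x) ≤
      ⨆ i, ENNReal.ofReal (Real.exp (A i + z i)) := fun k h =>
    le_iSup_of_le k (ENNReal.ofReal_le_ofReal (Real.exp_le_exp.2 h))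
  have hn : ∀ {x : ℝ} (k : ι), x ≤ A k - z k → ENNReal.ofReal (Real.exp x) ≤
      ⨆ i, ENNReal.ofReal (Real.exp (A i - z i)) := fun k h =>
    le_iSup_of_le k (ENNReal.ofReal_le_ofReal (Real.exp_le_exp.2 h))
  rcases le_total 0 (z i) with h | h
  · exact add_le_add (hp i (by rw [abs_of_nonneg h])) (hn j (by linarith [le_abs_self (z j)]))
  · rw [add_comm]
    exact add_le_add (hp j (by linarith [neg_abs_le (z j)]))
      (hn i (by rw [abs_of_nonpos h, sub_eq_add_neg]))

/-- Symmetrization and contraction in one coordinate, for exponential moments of a supremum. -/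
theorem lintegral_iSup_exp_le {ι : Type*} [Countable ι] (Q : Measure S) [IsProbabilityMeasure Q]
    (A : ι → ℝ) {f : ι → S → ℝ} (hf : ∀ i, Measurable (f i)) (hfi : ∀ i, Integrable (f i) Q)
    (t : ℝ) (ht : 0 ≤ t) :
    ∫⁻ x, ⨆ i, ENNReal.ofReal (Real.exp (A i + t * ((∫ y, |f i y| ∂Q) - |f i x|))) ∂Q ≤
      2⁻¹ * ∫⁻ x, ((⨆ i, ENNReal.ofReal (Real.exp (A i + 2 * t * f i x))) +
        ⨆ i, ENNReal.ofReal (Real.exp (A i - 2 * t * f i x))) ∂Q := by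
  have hmp : Measurable fun x => ⨆ i, ENNReal.ofReal (Real.exp (A i + |2 * t * f i x|)) := by
    refine Measurable.iSup fun i => ?_
    have := hf i
    fun_prop
  have hmm : Measurable fun x => ⨆ i, ENNReal.ofReal (Real.exp (A i - |2 * t * f i x|)) := by
    refine Measurable.iSup fun i => ?_
    have := hf i
    fun_prop
  have hpt : ∀ x i, ENNReal.ofReal (Real.exp (A i + t * ((∫ y, |f i y| ∂Q) - |f i x|))) ≤
      2⁻¹ * ((∫⁻ y, ⨆ i, ENNReal.ofReal (Real.exp (A i + |2 * t * f i y|)) ∂Q) +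
        ⨆ i, ENNReal.ofReal (Real.exp (A i - |2 * t * f i x|))) := by
    intro x i
    have hge : Integrable (fun y => A i + |2 * t * f i y|) Q :=
      (integrable_const _).add ((hfi i).const_mul _).abs
    have hint : ∫ y, (A i + |2 * t * f i y|) ∂Q = A i + 2 * t * ∫ y, |f i y| ∂Q := by
      rw [integral_add (integrable_const _) ((hfi i).const_mul _).abs]
      simp only [integral_const, probReal_univ, smul_eq_mul, one_mul]
      rw [← integral_const_mul]
      congr 2
      ext y
      rw [abs_mul, abs_of_nonneg (by positivity : 0 ≤ 2 * t)]
    have hj := ofReal_exp_integral_le hge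
    rw [hint] at hj
    set m := ∫ y, |f i y| ∂Q
    -- the arithmetic-geometric mean inequality separates the two samples
    have ham : Real.exp (A i + t * (m - |f i x|)) ≤
        2⁻¹ * (Real.exp (A i + 2 * t * m) + Real.exp (A i - |2 * t * f i x|)) := by
      have h2 : Real.exp (A i + t * (m - |f i x|)) =
          Real.exp ((A i + 2 * t * m) / 2) * Real.exp ((A i - |2 * t * f i x|) / 2) := by
        rw [← Real.exp_add, abs_mul, abs_of_nonneg (by positivity : 0 ≤ 2 * t)]
        ring_nf
      have h3 : ∀ y, Real.exp y = Real.exp (y / 2) ^ 2 := fun y => by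
        rw [← Real.exp_nat_mul]; push_cast; ring_nf
      rw [h2, h3 (A i + 2 * t * m), h3 (A i - |2 * t * f i x|)]
      nlinarith [sq_nonneg (Real.exp ((A i + 2 * t * m) / 2) -
        Real.exp ((A i - |2 * t * f i x|) / 2))]
    refine (ENNReal.ofReal_le_ofReal ham).trans ?_
    rw [ENNReal.ofReal_mul (by norm_num), ENNReal.ofReal_inv_of_pos (by norm_num),
      ENNReal.ofReal_ofNat, ENNReal.ofReal_add (Real.exp_pos _).le (Real.exp_pos _).le]
    gcongr
    · refine hj.trans (lintegral_mono fun y => ?_)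
      exact le_iSup (fun i => ENNReal.ofReal (Real.exp (A i + |2 * t * f i y|))) i
    · exact le_iSup (fun i => ENNReal.ofReal (Real.exp (A i - |2 * t * f i x|))) i
  calc _ ≤ ∫⁻ x, 2⁻¹ * ((∫⁻ y, ⨆ i, ENNReal.ofReal (Real.exp (A i + |2 * t * f i y|)) ∂Q) +
        ⨆ i, ENNReal.ofReal (Real.exp (A i - |2 * t * f i x|))) ∂Q :=
        lintegral_mono fun x => iSup_le (hpt x)
    _ = 2⁻¹ * ∫⁻ x, ((⨆ i, ENNReal.ofReal (Real.exp (A i + |2 * t * f i x|))) +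
        ⨆ i, ENNReal.ofReal (Real.exp (A i - |2 * t * f i x|))) ∂Q := by
        rw [lintegral_const_mul' _ _ (by simp), lintegral_add_left measurable_const,
          lintegral_add_left hmp]
        simp
    _ ≤ _ := by
        refine mul_le_mul_right (lintegral_mono fun x => ?_) _
        exact iSup_exp_abs_add_le A _

variable {N : ℕ}

/-- Symmetrization, contraction and passage to a finite set `V`: if the support function of the
vectors `u i` is at most twice that of `V`, then the exponential moments of the supremum of
`∑ⱼ (E|f_u(X)| - |f_u(Xⱼ)|)` over these vectors are bounded by a sum over `V`. The linear term
`∑ₖ uₖ aₖ` makes an induction on the sample size possible. -/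
theorem lintegral_pi_iSup_exp_le {ι : Type*} [Countable ι] (Q : Measure S)
    [IsProbabilityMeasure Q] {h : Fin N → S → ℝ} (hh : ∀ k, Measurable (h k))
    (hhi : ∀ k, Integrable (h k) Q) (u : ι → EuclideanSpace ℝ (Fin N))
    (V : Finset (EuclideanSpace ℝ (Fin N)))
    (hV : ∀ i, ∀ a : Fin N → ℝ, ∃ v ∈ V, ∑ k, u i k * a k ≤ 2 * ∑ k, v k * a k)
    (t : ℝ) (ht : 0 ≤ t) (n : ℕ) (a : Fin N → ℝ) :
    ∫⁻ x : Fin n → S, ⨆ i, ENNReal.ofReal (Real.exp (∑ k, u i k * a k +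
        t * ∑ j, ((∫ y, |lin h (u i) y| ∂Q) - |lin h (u i) (x j)|))) ∂(Measure.pi fun _ => Q) ≤
      ∑ v ∈ V, ENNReal.ofReal (Real.exp (2 * ∑ k, v k * a k)) *
        (∫⁻ x, ENNReal.ofReal (Real.cosh (4 * t * lin h v x)) ∂Q) ^ n := by
  have hlm : ∀ v : EuclideanSpace ℝ (Fin N), Measurable (lin h v) := fun v => by
    unfold lin; fun_prop
  have hli : ∀ v : EuclideanSpace ℝ (Fin N), Integrable (lin h v) Q := fun v => by
    unfold lin; exact integrable_finsetSum _ fun j _ => (hhi j).const_mul _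
  induction n generalizing a with
  | zero =>
    simp only [Finset.univ_eq_empty, Finset.sum_empty, mul_zero, add_zero, pow_zero, mul_one]
    rw [lintegral_const, measure_univ, mul_one]
    refine iSup_le fun i => ?_
    obtain ⟨v, hv, hle⟩ := hV i a
    exact (ENNReal.ofReal_le_ofReal (Real.exp_le_exp.2 hle)).trans
      (Finset.single_le_sum (f := fun v : EuclideanSpace ℝ (Fin N) =>
        ENNReal.ofReal (Real.exp (2 * ∑ k, v k * a k))) (fun _ _ => zero_le) hv)
  | succ n ih =>
    let T : ι → (Fin n → S) → ℝ := fun i y =>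
      t * ∑ j, ((∫ y, |lin h (u i) y| ∂Q) - |lin h (u i) (y j)|)
    have hT : ∀ i, Measurable (T i) := fun i => by
      have := hlm (u i)
      fun_prop
    have hshift : ∀ (s : ℝ) (x : S) (w : EuclideanSpace ℝ (Fin N)),
        ∑ k, w k * (a k + s * h k x) = ∑ k, w k * a k + s * lin h w x := fun s x w => by
      unfold lin
      rw [Finset.mul_sum, ← Finset.sum_add_distrib]
      exact Finset.sum_congr rfl fun k _ => by ring
    have hcosh : ∀ v : EuclideanSpace ℝ (Fin N),
        Measurable fun x => ENNReal.ofReal (Real.cosh (4 * t * lin h v x)) := fun v => by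
      have := hlm v
      have h2 := Real.measurable_cosh
      fun_prop
    set F : ℝ → S → (Fin n → S) → ℝ≥0∞ := fun s x y =>
      ⨆ i, ENNReal.ofReal (Real.exp (∑ k, u i k * (a k + s * h k x) + T i y)) with hF
    have hFm : ∀ s, Measurable (Function.uncurry (F s)) := fun s => by
      refine Measurable.iSup fun i => ?_
      have := hT i
      fun_prop
    have hmp := measurePreserving_piFinSuccAbove (fun _ : Fin (n + 1) => Q) 0
    calc _ = ∫⁻ p : S × (Fin n → S), ⨆ i, ENNReal.ofReal (Real.exp (∑ k, u i k * a k +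
          t * (((∫ y, |lin h (u i) y| ∂Q) - |lin h (u i) p.1|)) + T i p.2))
          ∂(Q.prod (Measure.pi fun _ => Q)) := by
          rw [← hmp.lintegral_comp_emb (MeasurableEquiv.measurableEmbedding _)]
          refine lintegral_congr fun x => iSup_congr fun i => ?_
          simp only [T, Fin.sum_univ_succ, mul_add, add_assoc]
          rfl
      _ = ∫⁻ y, ∫⁻ x, ⨆ i, ENNReal.ofReal (Real.exp (∑ k, u i k * a k + T i y +
          t * (((∫ y, |lin h (u i) y| ∂Q) - |lin h (u i) x|)))) ∂Q ∂(Measure.pi fun _ => Q) := by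
          rw [lintegral_prod_symm]
          · refine lintegral_congr fun y => lintegral_congr fun x => iSup_congr fun i => ?_
            rw [add_right_comm]
          · refine (Measurable.iSup fun i => ?_).aemeasurable
            have := hT i
            have := hlm (u i)
            fun_prop
      _ ≤ ∫⁻ y, 2⁻¹ * ∫⁻ x, (F (2 * t) x y + F (-(2 * t)) x y) ∂Q ∂(Measure.pi fun _ => Q) := by
          refine lintegral_mono fun y => ?_
          refine (lintegral_iSup_exp_le Q (fun i => ∑ k, u i k * a k + T i y)
            (fun i => hlm (u i)) (fun i => hli (u i)) t ht).trans_eq ?_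
          congr 1
          refine lintegral_congr fun x => ?_
          simp only [hF, hshift]
          congr 1 <;> refine iSup_congr fun i => ?_ <;> ring_nf
      _ = 2⁻¹ * ∫⁻ x, ((∫⁻ y, F (2 * t) x y ∂(Measure.pi fun _ => Q)) +
            ∫⁻ y, F (-(2 * t)) x y ∂(Measure.pi fun _ => Q)) ∂Q := by
          rw [lintegral_const_mul' _ _ (by simp), lintegral_lintegral_swap]
          · congr 1
            refine lintegral_congr fun x => ?_
            exact lintegral_add_left ((hFm (2 * t)).of_uncurry_left) _
          · exact (((hFm _).add (hFm _)).comp measurable_swap).aemeasurable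
      _ ≤ 2⁻¹ * ∫⁻ x, ∑ v ∈ V, 2 * (ENNReal.ofReal (Real.exp (2 * ∑ k, v k * a k)) *
            (∫⁻ x, ENNReal.ofReal (Real.cosh (4 * t * lin h v x)) ∂Q) ^ n *
            ENNReal.ofReal (Real.cosh (4 * t * lin h v x))) ∂Q := by
          gcongr with x
          refine (add_le_add (ih _) (ih _)).trans_eq ?_
          rw [← Finset.sum_add_distrib]
          refine Finset.sum_congr rfl fun v _ => ?_
          rw [← add_mul, mul_right_comm, ← mul_assoc]
          congr 1
          have hre : Real.exp (2 * ∑ k, v k * (a k + 2 * t * h k x)) +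
              Real.exp (2 * ∑ k, v k * (a k + -(2 * t) * h k x)) =
              2 * (Real.exp (2 * ∑ k, v k * a k) * Real.cosh (4 * t * lin h v x)) := by
            rw [hshift, hshift, Real.cosh_eq, mul_add, mul_add, Real.exp_add, Real.exp_add]
            ring_nf
          rw [← ENNReal.ofReal_add (Real.exp_pos _).le (Real.exp_pos _).le, hre,
            ENNReal.ofReal_mul zero_le_two, ENNReal.ofReal_mul (Real.exp_pos _).le,
            ENNReal.ofReal_ofNat]
      _ = _ := by
          rw [lintegral_finsetSum _ fun v _ => ((hcosh v).const_mul _).const_mul _,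
            Finset.mul_sum]
          refine Finset.sum_congr rfl fun v _ => ?_
          rw [lintegral_const_mul _ ((hcosh v).const_mul _), lintegral_const_mul _ (hcosh v),
            ← mul_assoc, ENNReal.inv_mul_cancel (by simp) (by simp), one_mul, pow_succ, mul_assoc]

end Symmetrization

/-! ### Sparse nets and shelling -/

section Net

/-- A finite-dimensional unit ball contains a set of at most `5 ^ dim` points whose support function
is at least half the norm: a maximal `1/2`-separated subset. -/
theorem exists_finset_norm_le_two_mul_inner (E : Type*) [NormedAddCommGroup E]
    [InnerProductSpace ℝ E] [FiniteDimensional ℝ E] :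
    ∃ V : Finset E, V.card ≤ 5 ^ Module.finrank ℝ E ∧ (∀ c ∈ V, ‖c‖ ≤ 1) ∧
      ∀ b : E, ∃ c ∈ V, ‖b‖ ≤ 2 * inner ℝ b c := by
  classical
  let R : Finset E → Prop := fun s => (∀ c ∈ s, ‖c‖ ≤ 2) ∧ ∀ c ∈ s, ∀ d ∈ s, c ≠ d → 1 ≤ ‖c - d‖
  have hcard : ∀ s, R s → s.card ≤ 5 ^ Module.finrank ℝ E := fun s hs =>
    Besicovitch.card_le_of_separated s hs.1 hs.2
  obtain ⟨s, hs, hk⟩ : ∃ s, R s ∧ s.card =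
      Nat.findGreatest (fun k => ∃ s, R s ∧ s.card = k) (5 ^ Module.finrank ℝ E) :=
    Nat.findGreatest_spec (P := fun k => ∃ s, R s ∧ s.card = k) (m := 0) (Nat.zero_le _)
      ⟨∅, by simp [R], rfl⟩
  have hmax : ∀ s', R s' → s'.card ≤ s.card := fun s' hs' => by
    rw [hk]
    exact Nat.le_findGreatest (hcard s' hs') ⟨s', hs', rfl⟩
  have hnet : ∀ w : E, ‖w‖ ≤ 2 → ∃ c ∈ s, ‖w - c‖ < 1 := fun w hw => by
    by_contra! hcon
    have hws : w ∉ s := fun h => by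
      have := hcon w h
      simp at this
      linarith
    have hR : R (insert w s) := by
      refine ⟨fun c hc => ?_, fun c hc d hd hcd => ?_⟩
      · rcases Finset.mem_insert.1 hc with rfl | hc
        · exact hw
        · exact hs.1 c hc
      · rcases Finset.mem_insert.1 hc with h1 | h1 <;> rcases Finset.mem_insert.1 hd with h2 | h2
        · exact absurd (h1.trans h2.symm) hcd
        · rw [h1]; exact hcon d h2
        · rw [norm_sub_rev, h2]; exact hcon c h1
        · exact hs.2 c h1 d h2 hcd
    have := hmax _ hR
    rw [Finset.card_insert_of_notMem hws] at this
    omega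
  refine ⟨s.image fun c => (2⁻¹ : ℝ) • c, Finset.card_image_le.trans (hcard s hs), ?_, ?_⟩
  · intro v hv
    obtain ⟨c, hc, rfl⟩ := Finset.mem_image.1 hv
    have := hs.1 c hc
    rw [norm_smul]
    norm_num
    linarith
  · intro b
    -- approximate the point of the sphere of radius `2` in the direction of `b`
    obtain ⟨c, hc, hlt⟩ := hnet ((2 * ‖b‖⁻¹) • b) (by
      rw [norm_smul, norm_mul, norm_inv, norm_norm, mul_assoc]
      have := inv_mul_le_one (a := ‖b‖)
      norm_num
      linarith)
    refine ⟨_, Finset.mem_image_of_mem _ hc, ?_⟩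
    have h1 : inner ℝ b ((2 * ‖b‖⁻¹) • b) = 2 * ‖b‖ := by
      rw [inner_smul_right, real_inner_self_eq_norm_sq]
      rcases eq_or_ne ‖b‖ 0 with h | h
      · simp [h]
      · field_simp
    have h2 := real_inner_le_norm b ((2 * ‖b‖⁻¹) • b - c)
    rw [inner_sub_right, h1] at h2
    rw [inner_smul_right]
    nlinarith [norm_nonneg b]

end Net

section Sparse

variable {N : ℕ}

theorem card_filter_card_le (N d : ℕ) :
    (Finset.univ.filter fun J : Finset (Fin N) => J.card ≤ d).card = chooseLE N d := by
  unfold chooseLE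
  rw [Finset.card_eq_sum_card_fiberwise (f := Finset.card) (t := Finset.range (d + 1))]
  · refine Finset.sum_congr rfl fun k hk => ?_
    have : ({J ∈ Finset.univ.filter fun J : Finset (Fin N) => J.card ≤ d | J.card = k}) =
        Finset.powersetCard k Finset.univ := by
      ext J
      simp only [Finset.mem_range] at hk
      simp only [Finset.mem_filter, Finset.mem_univ, true_and, Finset.mem_powersetCard,
        Finset.subset_univ]
      omega
    rw [this, Finset.card_powersetCard, Finset.card_univ, Fintype.card_fin]
  · intro J hJ
    simp only [Finset.coe_filter, Finset.mem_univ, true_and, Set.mem_ofPred_eq] at hJ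
    simp only [Finset.coe_range, Set.mem_Iio]
    omega

/-- Extension by zero of a vector indexed by `J`. -/
def extendZero (J : Finset (Fin N)) (c : EuclideanSpace ℝ J) : EuclideanSpace ℝ (Fin N) :=
  WithLp.toLp 2 fun j => if hj : j ∈ J then c ⟨j, hj⟩ else 0

theorem sum_extendZero_mul (J : Finset (Fin N)) (c : EuclideanSpace ℝ J) (a : Fin N → ℝ) :
    ∑ k, extendZero J c k * a k = ∑ j : J, c j * a j := by
  have h1 : ∑ k, extendZero J c k * a k = ∑ k ∈ J, extendZero J c k * a k := by
    refine (Finset.sum_subset (Finset.subset_univ J) fun k _ hk => ?_).symm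
    simp [extendZero, hk]
  rw [h1, ← Finset.sum_coe_sort J fun k => extendZero J c k * a k]
  refine Finset.sum_congr rfl fun j _ => ?_
  simp [extendZero]

theorem norm_extendZero (J : Finset (Fin N)) (c : EuclideanSpace ℝ J) :
    ‖extendZero J c‖ = ‖c‖ := by
  rw [EuclideanSpace.norm_eq, EuclideanSpace.norm_eq]
  congr 1
  have := sum_extendZero_mul J c (extendZero J c)
  simp only [Real.norm_eq_abs, sq_abs]
  simp only [← sq] at this
  rw [this]
  refine Finset.sum_congr rfl fun j _ => ?_
  simp [extendZero, sq]

theorem dim_extendZero_le (J : Finset (Fin N)) (c : EuclideanSpace ℝ J) :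
    dim (extendZero J c) ≤ J.card := by
  refine Finset.card_le_card fun j hj => ?_
  by_contra hn
  simp [supp, extendZero, hn] at hj

/-- The sparse vectors of the unit ball contain a finite set of controlled size whose support
function is at least half that of all of them. -/
theorem exists_sparse_net (N d : ℕ) :
    ∃ V : Finset (EuclideanSpace ℝ (Fin N)), V.card ≤ 5 ^ d * chooseLE N d ∧
      (∀ v ∈ V, ‖v‖ ≤ 1 ∧ dim v ≤ d) ∧
      ∀ J : Finset (Fin N), J.card ≤ d → ∀ a : Fin N → ℝ,
        ∃ v ∈ V, √(∑ j ∈ J, a j ^ 2) ≤ 2 * ∑ k, v k * a k := by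
  classical
  choose W hWc hW1 hWi using
    fun J : Finset (Fin N) => exists_finset_norm_le_two_mul_inner (EuclideanSpace ℝ J)
  refine ⟨(Finset.univ.filter fun J : Finset (Fin N) => J.card ≤ d).biUnion fun J =>
    (W J).image (extendZero J), ?_, ?_, ?_⟩
  · refine (Finset.card_biUnion_le_card_mul _ _ (5 ^ d) fun J hJ => ?_).trans_eq ?_
    · refine Finset.card_image_le.trans ((hWc J).trans ?_)
      rw [finrank_euclideanSpace, Fintype.card_coe]
      exact Nat.pow_le_pow_right (by norm_num) (Finset.mem_filter.1 hJ).2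
    · rw [card_filter_card_le, mul_comm]
  · intro v hv
    obtain ⟨J, hJ, hv⟩ := Finset.mem_biUnion.1 hv
    obtain ⟨c, hc, rfl⟩ := Finset.mem_image.1 hv
    exact ⟨(norm_extendZero J c).trans_le (hW1 J c hc),
      (dim_extendZero_le J c).trans (Finset.mem_filter.1 hJ).2⟩
  · intro J hJ a
    obtain ⟨c, hc, hle⟩ := hWi J (WithLp.toLp 2 fun j => a j)
    refine ⟨extendZero J c, Finset.mem_biUnion.2 ⟨J, by simpa using hJ,
      Finset.mem_image_of_mem _ hc⟩, ?_⟩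
    rw [sum_extendZero_mul]
    rw [EuclideanSpace.norm_eq] at hle
    simp only [Real.norm_eq_abs, sq_abs, PiLp.inner_apply, RCLike.inner_apply, conj_trivial] at hle
    rw [Finset.sum_coe_sort J fun j => a j ^ 2] at hle
    exact hle

/-- The closed convex hull of the `d`-sparse vectors of the unit ball, described by its support
function. -/
def sparseHull (N d : ℕ) : Set (EuclideanSpace ℝ (Fin N)) :=
  {u | ∀ (a : Fin N → ℝ) (r : ℝ),
    (∀ J : Finset (Fin N), J.card ≤ d → √(∑ j ∈ J, a j ^ 2) ≤ r) → ∑ k, u k * a k ≤ r}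

theorem exists_le_of_mem_sparseHull {d : ℕ} {V : Finset (EuclideanSpace ℝ (Fin N))}
    (hV : ∀ J : Finset (Fin N), J.card ≤ d → ∀ a : Fin N → ℝ,
        ∃ v ∈ V, √(∑ j ∈ J, a j ^ 2) ≤ 2 * ∑ k, v k * a k)
    {u : EuclideanSpace ℝ (Fin N)} (hu : u ∈ sparseHull N d) (a : Fin N → ℝ) :
    ∃ v ∈ V, ∑ k, u k * a k ≤ 2 * ∑ k, v k * a k := by
  obtain ⟨v₀, hv₀, -⟩ := hV ∅ (by simp) a
  obtain ⟨v, hv, hmax⟩ := V.exists_max_image (fun v => 2 * ∑ k, v k * a k) ⟨v₀, hv₀⟩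
  refine ⟨v, hv, hu a _ fun J hJ => ?_⟩
  obtain ⟨w, hw, hle⟩ := hV J hJ a
  exact hle.trans (hmax w hw)

theorem sum_mul_le_sqrt {J : Finset (Fin N)} {a : Fin N → ℝ} {r : ℝ}
    (hr : √(∑ j ∈ J, a j ^ 2) ≤ r) (u : Fin N → ℝ) :
    ∑ j ∈ J, u j * a j ≤ r * √(∑ j ∈ J, u j ^ 2) := by
  refine (Real.sum_mul_le_sqrt_mul_sqrt J u a).trans ?_
  rw [mul_comm]
  gcongr

theorem sum_abs_le_sqrt_mul (J : Finset (Fin N)) {d : ℕ} (hd : J.card ≤ d) (u : Fin N → ℝ) :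
    ∑ j ∈ J, |u j| ≤ √d * √(∑ j ∈ J, u j ^ 2) := by
  have h := Real.sum_mul_le_sqrt_mul_sqrt J (fun _ => 1) fun j => |u j|
  simp only [one_mul, one_pow, Finset.sum_const, nsmul_eq_mul, mul_one, sq_abs] at h
  refine h.trans ?_
  gcongr

theorem exists_top_subset (g : Fin N → ℝ) (T : Finset (Fin N)) (d : ℕ) (hd : d ≤ T.card) :
    ∃ T₁ ⊆ T, T₁.card = d ∧ ∀ i ∈ T₁, ∀ j ∈ T \ T₁, g j ≤ g i := by
  induction d with
  | zero => exact ⟨∅, by simp, rfl, by simp⟩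
  | succ d ih =>
    obtain ⟨T₁, hT, hc, htop⟩ := ih (by omega)
    have hne : (T \ T₁).Nonempty := by
      rw [← Finset.card_pos, Finset.card_sdiff_of_subset hT]
      omega
    obtain ⟨i, hi, hmax⟩ := (T \ T₁).exists_max_image g hne
    obtain ⟨hiT, hi1⟩ := Finset.mem_sdiff.1 hi
    refine ⟨insert i T₁, Finset.insert_subset hiT hT, by rw [Finset.card_insert_of_notMem hi1, hc],
      fun k hk j hj => ?_⟩
    have hj' : j ∈ T \ T₁ := by
      simp only [Finset.mem_sdiff, Finset.mem_insert, not_or] at hj ⊢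
      exact ⟨hj.1, hj.2.2⟩
    rcases Finset.mem_insert.1 hk with rfl | hk
    · exact hmax j hj'
    · exact htop k hk j hj'

theorem abs_le_of_top {u : Fin N → ℝ} {T T₁ : Finset (Fin N)} {d : ℕ} (hd : 1 ≤ d)
    (hc : T₁.card = d) (htop : ∀ i ∈ T₁, ∀ j ∈ T \ T₁, |u j| ≤ |u i|) {j : Fin N}
    (hj : j ∈ T \ T₁) : |u j| ≤ (∑ i ∈ T₁, |u i|) / d := by
  have h := Finset.card_nsmul_le_sum T₁ (fun i => |u i|) |u j| fun i hi => htop i hi j hj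
  rw [hc, nsmul_eq_mul] at h
  have hd' : (0 : ℝ) < d := by exact_mod_cast hd
  rw [le_div_iff₀ hd', mul_comm]
  exact h

/-- The shelling argument: a vector is cut into blocks of `d` coordinates of decreasing size, and
the `ℓ₂`-norm of each block is controlled by the `ℓ₁`-norm of the preceding one. -/
theorem sum_mul_le_of_abs_le {d : ℕ} (hd : 1 ≤ d) {a : Fin N → ℝ} {r : ℝ}
    (hr : ∀ J : Finset (Fin N), J.card ≤ d → √(∑ j ∈ J, a j ^ 2) ≤ r) (u : Fin N → ℝ)
    (T : Finset (Fin N)) {b : ℝ} (hb0 : 0 ≤ b) (hb : ∀ j ∈ T, |u j| ≤ b) :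
    ∑ j ∈ T, u j * a j ≤ r * (√d * b + (∑ j ∈ T, |u j|) / √d) := by
  have hr0 : 0 ≤ r := (Real.sqrt_nonneg _).trans (hr ∅ (by simp))
  have hd' : (0 : ℝ) < d := by exact_mod_cast hd
  have hsd : 0 < √(d : ℝ) := Real.sqrt_pos.2 hd'
  have hblock : ∀ (T : Finset (Fin N)) (b : ℝ), T.card ≤ d → 0 ≤ b → (∀ j ∈ T, |u j| ≤ b) →
      ∑ j ∈ T, u j * a j ≤ r * (√d * b) := fun T b hT hb0 hb => by
    refine (sum_mul_le_sqrt (hr T hT) u).trans (mul_le_mul_of_nonneg_left ?_ hr0)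
    have h1 : ∑ j ∈ T, u j ^ 2 ≤ T.card • b ^ 2 := Finset.sum_le_card_nsmul _ _ _ fun j hj => by
      rw [← sq_abs]
      exact pow_le_pow_left₀ (abs_nonneg _) (hb j hj) 2
    calc √(∑ j ∈ T, u j ^ 2) ≤ √(d * b ^ 2) := by
          refine Real.sqrt_le_sqrt (h1.trans ?_)
          rw [nsmul_eq_mul]
          gcongr
      _ = √d * b := by rw [Real.sqrt_mul hd'.le, Real.sqrt_sq hb0]
  induction hm : T.card using Nat.strong_induction_on generalizing T b with
  | _ m ih =>
    have hnn : 0 ≤ ∑ j ∈ T, |u j| := Finset.sum_nonneg fun j _ => abs_nonneg _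
    rcases le_total T.card d with hT | hT
    · refine (hblock T b hT hb0 hb).trans (mul_le_mul_of_nonneg_left ?_ hr0)
      have : 0 ≤ (∑ j ∈ T, |u j|) / √d := by positivity
      linarith
    · obtain ⟨T₁, hT₁, hc, htop⟩ := exists_top_subset (fun j => |u j|) T d hT
      have h1 := hblock T₁ b hc.le hb0 fun j hj => hb j (hT₁ hj)
      have h2 := ih (T \ T₁).card (by rw [Finset.card_sdiff_of_subset hT₁]; omega) (T \ T₁)
        (b := (∑ i ∈ T₁, |u i|) / d)
        (div_nonneg (Finset.sum_nonneg fun j _ => abs_nonneg _) hd'.le)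
        (fun j hj => abs_le_of_top hd hc htop hj) rfl
      have h3 : √(d : ℝ) * ((∑ i ∈ T₁, |u i|) / d) = (∑ i ∈ T₁, |u i|) / √d := by
        rw [← mul_div_assoc, div_eq_div_iff hd'.ne' hsd.ne', mul_comm √(d : ℝ), mul_assoc,
          Real.mul_self_sqrt hd'.le]
      rw [← Finset.sum_sdiff hT₁, ← Finset.sum_sdiff hT₁ (f := fun j => |u j|)]
      rw [h3] at h2
      rw [add_div]
      linarith [mul_add r (√d * b) ((∑ i ∈ T₁, |u i|) / √d + (∑ i ∈ T \ T₁, |u i|) / √d),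
        mul_add r ((∑ i ∈ T₁, |u i|) / √d) ((∑ i ∈ T \ T₁, |u i|) / √d)]

/-- A vector of the cone `C_J` is controlled by its restriction to a set of at most `2d`
coordinates that contains `J`: both its `ℓ₂`-norm and its gauge with respect to the hull of the
`d`-sparse unit vectors. -/
theorem exists_superset_of_mem_cone {d : ℕ} (hd : 1 ≤ d) {J : Finset (Fin N)} (hJ : J.card ≤ d)
    {u : EuclideanSpace ℝ (Fin N)} (hu : u ∈ cone J) :
    ∃ I, J ⊆ I ∧ I.card ≤ 2 * d ∧ ‖u‖ ≤ 2 * √(∑ j ∈ I, u j ^ 2) ∧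
      ∀ (a : Fin N → ℝ) (r : ℝ),
        (∀ J : Finset (Fin N), J.card ≤ d → √(∑ j ∈ J, a j ^ 2) ≤ r) →
          ∑ k, u k * a k ≤ r * (3 * √(∑ j ∈ I, u j ^ 2)) := by
  have hd' : (0 : ℝ) < d := by exact_mod_cast hd
  have hsd : 0 < √(d : ℝ) := Real.sqrt_pos.2 hd'
  have hnorm : ‖u‖ = √(∑ j, u j ^ 2) := by
    rw [EuclideanSpace.norm_eq]; simp only [Real.norm_eq_abs, sq_abs]
  have hmono : ∀ {K L : Finset (Fin N)}, K ⊆ L → √(∑ j ∈ K, u j ^ 2) ≤ √(∑ j ∈ L, u j ^ 2) :=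
    fun h => Real.sqrt_le_sqrt (Finset.sum_le_sum_of_subset_of_nonneg h fun _ _ _ => sq_nonneg _)
  have hJs := sum_abs_le_sqrt_mul J hJ u
  rcases le_total Jᶜ.card d with hc | hc
  · refine ⟨Finset.univ, Finset.subset_univ J, ?_, ?_, fun a r hr => ?_⟩
    · have := Finset.card_add_card_compl J
      rw [Finset.card_univ]
      omega
    · rw [hnorm]
      linarith [Real.sqrt_nonneg (∑ j, u j ^ 2)]
    · have hr0 : 0 ≤ r := (Real.sqrt_nonneg _).trans (hr ∅ (by simp))
      rw [← Finset.sum_add_sum_compl J]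
      have h1 := sum_mul_le_sqrt (hr J hJ) u
      have h2 := sum_mul_le_sqrt (hr _ hc) u
      have h3 := mul_le_mul_of_nonneg_left (hmono (Finset.subset_univ J)) hr0
      have h4 := mul_le_mul_of_nonneg_left (hmono (Finset.subset_univ Jᶜ)) hr0
      have h5 := mul_nonneg hr0 (Real.sqrt_nonneg (∑ j, u j ^ 2))
      linarith
  · obtain ⟨T, hT, hTc, htop⟩ := exists_top_subset (fun j => |u j|) Jᶜ d hc
    have hdisj : Disjoint J T := Finset.disjoint_right.2 fun j hj => Finset.mem_compl.1 (hT hj)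
    have hp : 0 ≤ ∑ j ∈ T, |u j| := Finset.sum_nonneg fun j _ => abs_nonneg _
    have hq : 0 ≤ ∑ j ∈ Jᶜ \ T, |u j| := Finset.sum_nonneg fun j _ => abs_nonneg _
    have hpq : ∑ j ∈ T, |u j| + ∑ j ∈ Jᶜ \ T, |u j| ≤ √d * √(∑ j ∈ J, u j ^ 2) := by
      rw [add_comm, Finset.sum_sdiff hT]
      exact (show _ ≤ _ from hu).trans hJs
    have hb : ∀ j ∈ Jᶜ \ T, |u j| ≤ (∑ i ∈ T, |u i|) / d := fun j hj =>
      abs_le_of_top hd hTc htop hj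
    have hsplit : ∀ g : Fin N → ℝ, ∑ j, g j = ∑ j ∈ J, g j + ∑ j ∈ T, g j + ∑ j ∈ Jᶜ \ T, g j :=
      fun g => by
        rw [← Finset.sum_add_sum_compl J, ← Finset.sum_sdiff hT]; ring
    refine ⟨J ∪ T, Finset.subset_union_left, ?_, ?_, fun a r hr => ?_⟩
    · refine (Finset.card_union_le _ _).trans ?_
      omega
    · have h1 : ∑ j ∈ Jᶜ \ T, u j ^ 2 ≤
          (∑ i ∈ T, |u i|) / d * ∑ j ∈ Jᶜ \ T, |u j| := by
        rw [Finset.mul_sum]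
        refine Finset.sum_le_sum fun j hj => ?_
        rw [← sq_abs, sq]
        exact mul_le_mul_of_nonneg_right (hb j hj) (abs_nonneg _)
      have h2 : (∑ i ∈ T, |u i|) / d * ∑ j ∈ Jᶜ \ T, |u j| ≤ ∑ j ∈ J, u j ^ 2 := by
        rw [div_mul_eq_mul_div, div_le_iff₀ hd']
        have h3 := pow_le_pow_left₀ (add_nonneg hp hq) hpq 2
        rw [mul_pow, Real.sq_sqrt hd'.le,
          Real.sq_sqrt (Finset.sum_nonneg fun _ _ => sq_nonneg _)] at h3
        nlinarith
      have h4 : 0 ≤ ∑ j ∈ T, u j ^ 2 := Finset.sum_nonneg fun _ _ => sq_nonneg _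
      have h5 : 0 ≤ ∑ j ∈ J, u j ^ 2 := Finset.sum_nonneg fun _ _ => sq_nonneg _
      rw [hnorm, hsplit, Finset.sum_union hdisj]
      rw [show (2 : ℝ) * √(∑ j ∈ J, u j ^ 2 + ∑ j ∈ T, u j ^ 2) =
        √(4 * (∑ j ∈ J, u j ^ 2 + ∑ j ∈ T, u j ^ 2)) by
          rw [Real.sqrt_mul (by norm_num), show (4 : ℝ) = 2 ^ 2 by norm_num,
            Real.sqrt_sq (by norm_num)]]
      refine Real.sqrt_le_sqrt ?_
      linarith
    · have hr0 : 0 ≤ r := (Real.sqrt_nonneg _).trans (hr ∅ (by simp))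
      rw [hsplit]
      have h1 := sum_mul_le_sqrt (hr J hJ) u
      have h2 := sum_mul_le_sqrt (hr T hTc.le) u
      have h3 := sum_mul_le_of_abs_le hd hr u (Jᶜ \ T) (by positivity) hb
      have h4 : √(d : ℝ) * ((∑ i ∈ T, |u i|) / d) + (∑ j ∈ Jᶜ \ T, |u j|) / √d ≤
          √(∑ j ∈ J, u j ^ 2) := by
        have : √(d : ℝ) * ((∑ i ∈ T, |u i|) / d) = (∑ i ∈ T, |u i|) / √d := by
          rw [← mul_div_assoc, div_eq_div_iff hd'.ne' hsd.ne', mul_comm √(d : ℝ), mul_assoc,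
            Real.mul_self_sqrt hd'.le]
        rw [this, ← add_div, div_le_iff₀ hsd, mul_comm]
        exact hpq
      have h5 := mul_le_mul_of_nonneg_left h4 hr0
      have h6 := mul_le_mul_of_nonneg_left
        (hmono (Finset.subset_union_left : J ⊆ J ∪ T)) hr0
      have h7 := mul_le_mul_of_nonneg_left
        (hmono (Finset.subset_union_right : T ⊆ J ∪ T)) hr0
      linarith

end Sparse

/-! ### Lower deviations of empirical `L₁`-norms -/

section Dictionary

variable {S : Type*} {N : ℕ}

theorem lin_smul (h : Fin N → S → ℝ) (s : ℝ) (u : EuclideanSpace ℝ (Fin N)) (x : S) :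
    lin h (s • u) x = s * lin h u x := by
  unfold lin
  rw [Finset.mul_sum]
  exact Finset.sum_congr rfl fun j _ => by simp [mul_assoc]

theorem lin_sub (h : Fin N → S → ℝ) (u v : EuclideanSpace ℝ (Fin N)) :
    lin h (u - v) = lin h u - lin h v := by
  ext x
  simp [lin, sub_mul]

variable [MeasurableSpace S] {h : Fin N → S → ℝ} {Q : Measure S}

theorem measurable_lin (hh : ∀ k, Measurable (h k)) (u : EuclideanSpace ℝ (Fin N)) :
    Measurable (lin h u) := by
  unfold lin; fun_prop

theorem integrable_lin (hhi : ∀ k, Integrable (h k) Q) (u : EuclideanSpace ℝ (Fin N)) :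
    Integrable (lin h u) Q := by
  unfold lin; exact integrable_finsetSum _ fun j _ => (hhi j).const_mul _

theorem continuous_integral_abs_lin (hhi : ∀ k, Integrable (h k) Q) :
    Continuous fun u : EuclideanSpace ℝ (Fin N) => ∫ y, |lin h u y| ∂Q := by
  rw [continuous_iff_continuousAt]
  intro u
  refine continuousAt_of_dominated (bound := fun y => ∑ j, (‖u‖ + 1) * |h j y|) ?_ ?_ ?_ ?_
  · exact Filter.Eventually.of_forall fun w => (integrable_lin hhi w).abs.aestronglyMeasurable
  · filter_upwards [Metric.ball_mem_nhds u one_pos] with w hw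
    refine Filter.Eventually.of_forall fun y => ?_
    rw [Real.norm_eq_abs, abs_abs]
    unfold lin
    refine (Finset.abs_sum_le_sum_abs _ _).trans (Finset.sum_le_sum fun j _ => ?_)
    rw [abs_mul]
    gcongr
    rw [mem_ball_iff_norm] at hw
    have h1 := PiLp.norm_apply_le w j
    have h2 := norm_le_norm_add_norm_sub u w
    rw [Real.norm_eq_abs] at h1
    rw [norm_sub_rev] at hw
    linarith
  · exact integrable_finsetSum _ fun j _ => ((hhi j).abs).const_mul _
  · refine Filter.Eventually.of_forall fun y => Continuous.continuousAt ?_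
    unfold lin
    fun_prop

theorem zero_mem_sparseHull (N d : ℕ) : (0 : EuclideanSpace ℝ (Fin N)) ∈ sparseHull N d :=
  fun a r hr => by simpa using (Real.sqrt_nonneg _).trans (hr ∅ (by simp))

/-- Uniform lower deviations of the empirical `L₁`-norms over the sparse hull. -/
theorem measure_exists_sparseHull_le [IsProbabilityMeasure Q] (hh : ∀ k, Measurable (h k))
    (hhi : ∀ k, Integrable (h k) Q) (n d : ℕ) {c τ : ℝ} (hc : 0 < c) (hτ : 0 ≤ τ) (hτ1 : τ ≤ 1)
    (hb : ∀ v : EuclideanSpace ℝ (Fin N), ‖v‖ ≤ 1 → dim v ≤ d →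
      ∫⁻ x, ENNReal.ofReal (psiOne (|lin h v x| / c)) ∂Q ≤ 1) :
    (Measure.pi fun _ : Fin n => Q) {x | ∃ u ∈ sparseHull N d,
        n * (36 * c * τ) < ∑ j, ((∫ y, |lin h u y| ∂Q) - |lin h u (x j)|)} ≤
      ENNReal.ofReal ((5 ^ d * chooseLE N d : ℕ) * Real.exp (-(8 * (n * τ ^ 2)))) := by
  obtain ⟨V, hVc, hV1, hV⟩ := exists_sparse_net N d
  have : Nonempty (sparseHull N d) := ⟨⟨0, zero_mem_sparseHull N d⟩⟩
  -- a countable dense subset suffices, by continuity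
  let u : ℕ → EuclideanSpace ℝ (Fin N) := fun i => TopologicalSpace.denseSeq (sparseHull N d) i
  -- after symmetrization (`2t`) and the net (factor `2`) the exponent is `4 t f_v`
  set t := τ / (4 * c) with ht
  have ht0 : 0 ≤ t := by positivity
  have htc : 4 * t * c = τ := by rw [ht]; field_simp
  let G : ℕ → (Fin n → S) → ℝ≥0∞ := fun i x => ENNReal.ofReal (Real.exp (∑ k, u i k * (0 : ℝ) +
        t * ∑ j, ((∫ y, |lin h (u i) y| ∂Q) - |lin h (u i) (x j)|)))
  let F : (Fin n → S) → ℝ≥0∞ := fun x => ⨆ i, G i x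
  have hF : Measurable F := Measurable.iSup fun i => by
    have := measurable_lin hh (u i)
    fun_prop
  have hsub : {x : Fin n → S | ∃ u ∈ sparseHull N d,
        n * (36 * c * τ) < ∑ j, ((∫ y, |lin h u y| ∂Q) - |lin h u (x j)|)} ⊆
      {x | ENNReal.ofReal (Real.exp (9 * (n * τ ^ 2))) ≤ F x} := by
    rintro x ⟨w, hw, hlt⟩
    have hcont : Continuous fun w : sparseHull N d =>
        ∑ j, ((∫ y, |lin h w y| ∂Q) - |lin h w (x j)|) := by
      have h1 := continuous_integral_abs_lin hhi
      refine continuous_finsetSum _ fun j _ => ?_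
      refine (h1.comp continuous_subtype_val).sub ?_
      unfold lin
      fun_prop
    obtain ⟨i, hi⟩ := (TopologicalSpace.denseRange_denseSeq (sparseHull N d)).exists_mem_open
      (isOpen_lt continuous_const hcont) ⟨⟨w, hw⟩, hlt⟩
    refine le_trans (b := G i x) ?_ (le_iSup (fun i => G i x) i)
    refine (ENNReal.ofReal_le_ofReal (Real.exp_le_exp.2 ?_))
    simp only [mul_zero, Finset.sum_const_zero, zero_add]
    calc 9 * (n * τ ^ 2) = t * (n * (36 * c * τ)) := by
          rw [← htc]; ring
      _ ≤ _ := mul_le_mul_of_nonneg_left (le_of_lt hi) ht0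
  have hint := lintegral_pi_iSup_exp_le Q hh hhi u V
    (fun i a => exists_le_of_mem_sparseHull hV (TopologicalSpace.denseSeq (sparseHull N d) i).2 a)
    t ht0 n (fun _ => 0)
  have hsum : ∑ v ∈ V, ENNReal.ofReal (Real.exp (2 * ∑ k, v k * (0 : ℝ))) *
        (∫⁻ x, ENNReal.ofReal (Real.cosh (4 * t * lin h v x)) ∂Q) ^ n ≤
      ENNReal.ofReal ((5 ^ d * chooseLE N d : ℕ) * Real.exp (n * τ ^ 2)) := by
    calc _ ≤ ∑ v ∈ V, ENNReal.ofReal (Real.exp (n * τ ^ 2)) := by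
          refine Finset.sum_le_sum fun v hv => ?_
          have h1 := lintegral_cosh_mul_le (s := 4 * t) hc (hb v (hV1 v hv).1 (hV1 v hv).2)
            (by rw [abs_of_nonneg (by positivity), htc]; exact hτ1)
          rw [htc] at h1
          simp only [mul_zero, Finset.sum_const_zero, Real.exp_zero, ENNReal.ofReal_one, one_mul]
          refine (pow_le_pow_left₀ zero_le h1 n).trans_eq ?_
          rw [← ENNReal.ofReal_pow (Real.exp_pos _).le, ← Real.exp_nat_mul]
      _ = ENNReal.ofReal (V.card * Real.exp (n * τ ^ 2)) := by
          rw [Finset.sum_const, nsmul_eq_mul, ENNReal.ofReal_mul (by positivity),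
            ENNReal.ofReal_natCast]
      _ ≤ _ := by
          refine ENNReal.ofReal_le_ofReal ?_
          gcongr
  calc _ ≤ (Measure.pi fun _ : Fin n => Q)
        {x | ENNReal.ofReal (Real.exp (9 * (n * τ ^ 2))) ≤ F x} := measure_mono hsub
    _ ≤ (∫⁻ x, F x ∂(Measure.pi fun _ : Fin n => Q)) /
        ENNReal.ofReal (Real.exp (9 * (n * τ ^ 2))) :=
        meas_ge_le_lintegral_div hF.aemeasurable (by simpa using Real.exp_pos _)
          ENNReal.ofReal_ne_top
    _ ≤ ENNReal.ofReal ((5 ^ d * chooseLE N d : ℕ) * Real.exp (n * τ ^ 2)) /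
        ENNReal.ofReal (Real.exp (9 * (n * τ ^ 2))) := by
        gcongr
        exact hint.trans hsum
    _ = _ := by
        rw [← ENNReal.ofReal_div_of_pos (Real.exp_pos _), mul_div_assoc, ← Real.exp_sub]
        ring_nf

end Dictionary

section Counting

theorem one_le_chooseLE (N d : ℕ) : 1 ≤ chooseLE N d := by
  unfold chooseLE
  rw [Finset.sum_range_succ']
  simp

theorem lt_chooseLE {N d : ℕ} (hd : 1 ≤ d) : N < chooseLE N d := by
  unfold chooseLE
  have h : Finset.range 2 ⊆ Finset.range (d + 1) := Finset.range_mono (by omega)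
  refine lt_of_lt_of_le ?_ (Finset.sum_le_sum_of_subset h)
  simp [Finset.sum_range_succ]

/-- The bound `(eN/d)^d` for the number of subsets of cardinality at most `d`. -/
theorem chooseLE_le_exp {N d : ℕ} (hd : 1 ≤ d) (hdN : d ≤ N) :
    (chooseLE N d : ℝ) ≤ Real.exp (d * (1 + Real.log (N / d))) := by
  have hd0 : (0 : ℝ) < d := by exact_mod_cast hd
  have hN0 : (0 : ℝ) < N := by exact_mod_cast hd.trans hdN
  have hle1 : (d / N : ℝ) ≤ 1 := (div_le_one hN0).2 (by exact_mod_cast hdN)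
  have h1 : (chooseLE N d : ℝ) * (d / N : ℝ) ^ d ≤ Real.exp d := by
    calc (chooseLE N d : ℝ) * (d / N : ℝ) ^ d
        = ∑ j ∈ Finset.range (d + 1), (d / N : ℝ) ^ d * (N.choose j : ℝ) := by
          unfold chooseLE
          push_cast
          rw [Finset.sum_mul]
          exact Finset.sum_congr rfl fun j _ => mul_comm _ _
      _ ≤ ∑ j ∈ Finset.range (d + 1), (d / N : ℝ) ^ j * 1 ^ (N - j) * (N.choose j : ℝ) := by
          refine Finset.sum_le_sum fun j hj => ?_
          rw [one_pow, mul_one]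
          gcongr ?_ * _
          exact pow_le_pow_of_le_one (by positivity) hle1
            (Nat.lt_succ_iff.1 (Finset.mem_range.1 hj))
      _ ≤ ∑ j ∈ Finset.range (N + 1), (d / N : ℝ) ^ j * 1 ^ (N - j) * (N.choose j : ℝ) :=
          Finset.sum_le_sum_of_subset_of_nonneg (Finset.range_mono (by omega))
            fun _ _ _ => by positivity
      _ = (d / N + 1 : ℝ) ^ N := (add_pow _ _ _).symm
      _ ≤ Real.exp (d / N) ^ N :=
          pow_le_pow_left₀ (by positivity) (Real.add_one_le_exp _) N
      _ = Real.exp d := by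
          rw [← Real.exp_nat_mul, mul_div_cancel₀ _ hN0.ne']
  have h2 : (d / N : ℝ) ^ d = Real.exp (-(d * Real.log (N / d))) := by
    rw [show (d / N : ℝ) = Real.exp (-Real.log (N / d)) by
      rw [Real.exp_neg, Real.exp_log (by positivity), inv_div], ← Real.exp_nat_mul]
    ring_nf
  rw [h2, Real.exp_neg, ← div_eq_mul_inv, div_le_iff₀ (Real.exp_pos _), ← Real.exp_add] at h1
  refine h1.trans_eq ?_
  ring_nf

/-- The entropy of the sparse net is absorbed by the exponent `8 A d log (N / d)`. -/
theorem net_card_mul_exp_le {N d : ℕ} (hd : 1 ≤ d) (hdN : d ≤ N)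
    (hL : 1 ≤ Real.log (N / d)) {A : ℝ} (hA : 1 ≤ A) :
    ((5 ^ d * chooseLE N d : ℕ) : ℝ) * Real.exp (-(8 * (A * d * Real.log (N / d)))) ≤
      (5 : ℝ) ^ (-(d * A)) * (chooseLE N d : ℝ) ^ (-A) := by
  set L := Real.log (N / d)
  have hM1 : (0 : ℝ) < chooseLE N d := by exact_mod_cast one_le_chooseLE N d
  have hd0 : (1 : ℝ) ≤ d := by exact_mod_cast hd
  have h5 : (5 : ℝ) ≤ Real.exp 2 := by
    have := Real.exp_one_gt_d9
    rw [show (2 : ℝ) = 1 + 1 by norm_num, Real.exp_add]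
    nlinarith
  have hW : ((5 ^ d * chooseLE N d : ℕ) : ℝ) ≤ Real.exp (4 * (d * L)) := by
    push_cast
    calc (5 : ℝ) ^ d * chooseLE N d ≤ Real.exp 2 ^ d * Real.exp (d * (1 + L)) := by
          gcongr
          exact chooseLE_le_exp hd hdN
      _ = Real.exp (d * 2 + d * (1 + L)) := by rw [← Real.exp_nat_mul, ← Real.exp_add]
      _ ≤ _ := Real.exp_le_exp.2 (by nlinarith)
  have hWpos : (0 : ℝ) < ((5 ^ d * chooseLE N d : ℕ) : ℝ) := by push_cast; positivity
  have hR : (5 : ℝ) ^ (-(d * A)) * (chooseLE N d : ℝ) ^ (-A) =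
      ((5 ^ d * chooseLE N d : ℕ) : ℝ) ^ (-A) := by
    push_cast
    rw [Real.mul_rpow (by positivity) hM1.le, ← Real.rpow_natCast, ← Real.rpow_mul (by norm_num)]
    ring_nf
  rw [hR]
  set W := ((5 ^ d * chooseLE N d : ℕ) : ℝ)
  have hw : Real.log W ≤ 4 * (d * L) := (Real.log_le_iff_le_exp hWpos).2 hW
  rw [Real.rpow_def_of_pos hWpos]
  nth_rewrite 1 [← Real.exp_log hWpos]
  rw [← Real.exp_add]
  refine Real.exp_le_exp.2 ?_
  have : 0 ≤ d * L := by positivity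
  nlinarith

end Counting

/-! ### Bernstein's inequality for i.i.d. subexponential variables -/

section Bernstein

variable {Ω α β : Type*} [MeasurableSpace Ω] [MeasurableSpace α] [MeasurableSpace β]
  {P : Measure Ω} {n : ℕ}

theorem iIndepFun_prodMk [IsProbabilityMeasure P] {X : Fin n → Ω → α} {ξ : Fin n → Ω → β}
    (hX : ∀ j, Measurable (X j)) (hξ : ∀ j, Measurable (ξ j)) (hXi : iIndepFun X P)
    (hξi : iIndepFun ξ P) (hi : IndepFun (fun ω j => X j ω) (fun ω j => ξ j ω) P) :
    iIndepFun (fun j ω => (X j ω, ξ j ω)) P := by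
  have : ∀ j, IsProbabilityMeasure (P.map (X j)) := fun j =>
    Measure.isProbabilityMeasure_map (hX j).aemeasurable
  have : ∀ j, IsProbabilityMeasure (P.map (ξ j)) := fun j =>
    Measure.isProbabilityMeasure_map (hξ j).aemeasurable
  rw [iIndepFun_iff_map_fun_eq_pi_map fun j => ((hX j).prodMk (hξ j)).aemeasurable]
  have h1 : ∀ j, P.map (fun ω => (X j ω, ξ j ω)) = (P.map (X j)).prod (P.map (ξ j)) := fun j =>
    (indepFun_iff_map_prod_eq_prod_map_map (hX j).aemeasurable (hξ j).aemeasurable).1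
      (hi.comp (measurable_pi_apply j) (measurable_pi_apply j))
  have h2 := (indepFun_iff_map_prod_eq_prod_map_map (measurable_pi_lambda _ hX).aemeasurable
    (measurable_pi_lambda _ hξ).aemeasurable).1 hi
  rw [(iIndepFun_iff_map_fun_eq_pi_map fun j => (hX j).aemeasurable).1 hXi,
    (iIndepFun_iff_map_fun_eq_pi_map fun j => (hξ j).aemeasurable).1 hξi] at h2
  have h3 := measurePreserving_arrowProdEquivProdArrow α β (Fin n) (fun j => P.map (X j))
    fun j => P.map (ξ j)
  simp_rw [h1]
  rw [← h3.symm.map_eq, ← h2, Measure.map_map (MeasurableEquiv.measurable _)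
    ((measurable_pi_lambda _ hX).prodMk (measurable_pi_lambda _ hξ))]
  rfl

variable {μ : Measure α} [IsProbabilityMeasure μ]

/-- Bernstein's inequality for subexponential variables, in the range `τ ≤ 1` of moderate
deviations. -/
theorem measure_mean_ge_le {W : Fin n → Ω → α} (hW : ∀ j, Measurable (W j))
    (hWμ : ∀ j, P.map (W j) = μ) (hWi : iIndepFun W P) {Z : α → ℝ} (hZ : Measurable Z)
    (hZi : Integrable Z μ) {c τ : ℝ} (hc : 0 < c)
    (hb : ∫⁻ x, ENNReal.ofReal (psiOne (|Z x| / c)) ∂μ ≤ 1) (hτ : 0 ≤ τ) (hτ1 : τ ≤ 1) :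
    P {ω | n * ((∫ x, Z x ∂μ) + 5 * c * τ) ≤ ∑ j, Z (W j ω)} ≤
      ENNReal.ofReal (Real.exp (-(4 * (n * τ ^ 2)))) := by
  set s := τ / c with hs
  have hs0 : 0 ≤ s := by positivity
  have hsc : s * c = τ := by rw [hs]; field_simp
  set m := ∫ x, Z x ∂μ
  have h1 := lintegral_exp_mul_le hZ hZi hc hb (by rwa [abs_of_nonneg hs0, hsc])
  rw [hsc] at h1
  let G : α → ℝ≥0∞ := fun x => ENNReal.ofReal (Real.exp (s * Z x))
  have hG : Measurable G := by fun_prop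
  have hprod : ∫⁻ ω, ∏ j, G (W j ω) ∂P ≤ ENNReal.ofReal (Real.exp (n * (s * m + τ ^ 2))) := by
    rw [lintegral_prod_eq_prod_lintegral_of_indepFun Finset.univ (fun j ω => G (W j ω))
      (hWi.comp (fun _ => G) fun _ => hG) fun j => hG.comp (hW j)]
    calc ∏ j, ∫⁻ ω, G (W j ω) ∂P ≤ ∏ _j : Fin n, ENNReal.ofReal (Real.exp (s * m + τ ^ 2)) := by
          refine Finset.prod_le_prod' fun j _ => ?_
          rw [← lintegral_map hG (hW j), hWμ j]
          exact h1
      _ = _ := by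
          rw [Finset.prod_const, Finset.card_univ, Fintype.card_fin,
            ← ENNReal.ofReal_pow (Real.exp_pos _).le, ← Real.exp_nat_mul]
  calc P {ω | n * (m + 5 * c * τ) ≤ ∑ j, Z (W j ω)}
      ≤ P {ω | ENNReal.ofReal (Real.exp (n * (s * m + 5 * τ ^ 2))) ≤ ∏ j, G (W j ω)} := by
        refine measure_mono fun ω hω => ?_
        simp only [Set.mem_ofPred_eq, G] at hω ⊢
        rw [← ENNReal.ofReal_prod_of_nonneg fun _ _ => (Real.exp_pos _).le, ← Real.exp_sum,
          ← Finset.mul_sum]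
        refine ENNReal.ofReal_le_ofReal (Real.exp_le_exp.2 ?_)
        calc n * (s * m + 5 * τ ^ 2) = s * (n * (m + 5 * c * τ)) := by rw [← hsc]; ring
          _ ≤ _ := mul_le_mul_of_nonneg_left hω hs0
    _ ≤ (∫⁻ ω, ∏ j, G (W j ω) ∂P) / ENNReal.ofReal (Real.exp (n * (s * m + 5 * τ ^ 2))) :=
        meas_ge_le_lintegral_div
          (Finset.measurable_prod _ fun j _ => hG.comp (hW j)).aemeasurable
          (by simpa using Real.exp_pos _) ENNReal.ofReal_ne_top
    _ ≤ ENNReal.ofReal (Real.exp (n * (s * m + τ ^ 2))) /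
        ENNReal.ofReal (Real.exp (n * (s * m + 5 * τ ^ 2))) := by gcongr
    _ = _ := by
        rw [← ENNReal.ofReal_div_of_pos (Real.exp_pos _), ← Real.exp_sub]
        ring_nf

theorem measure_abs_mean_gt_le {W : Fin n → Ω → α} (hn : 1 ≤ n) (hW : ∀ j, Measurable (W j))
    (hWμ : ∀ j, P.map (W j) = μ) (hWi : iIndepFun W P) {Z : α → ℝ} (hZ : Measurable Z)
    (hZf : psiOneNorm μ Z ≠ ∞) {τ : ℝ} (hτ : 0 ≤ τ) (hτ1 : τ ≤ 1) :
    P {ω | |∫ x, Z x ∂μ| + 10 * (psiOneNorm μ Z).toReal * τ < |(n : ℝ)⁻¹ * ∑ j, Z (W j ω)|} ≤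
      ENNReal.ofReal (2 * Real.exp (-(4 * (n * τ ^ 2)))) := by
  have hZi := integrable_of_psiOneNorm_ne_top hZ hZf
  have hn0 : (0 : ℝ) < n := by exact_mod_cast hn
  rcases eq_or_ne (psiOneNorm μ Z) 0 with h0 | h0
  · -- a variable of norm zero vanishes almost surely
    have hae := ae_eq_zero_of_psiOneNorm_eq_zero hZ h0
    have hall : ∀ᵐ ω ∂P, ∀ j, Z (W j ω) = 0 := by
      rw [ae_all_iff]
      intro j
      have : ∀ᵐ x ∂(P.map (W j)), Z x = 0 := by rw [hWμ j]; exact hae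
      exact ae_of_ae_map (hW j).aemeasurable this
    refine le_of_eq_of_le ?_ zero_le
    rw [← nonpos_iff_eq_zero, ← ae_iff.1 hall]
    refine measure_mono fun ω hω hz => ?_
    simp only [Set.mem_ofPred_eq, hz, h0] at hω
    simp only [Finset.sum_const_zero, mul_zero, abs_zero, ENNReal.toReal_zero, zero_mul,
      add_zero] at hω
    exact absurd hω (not_lt.2 (abs_nonneg _))
  set σ := (psiOneNorm μ Z).toReal with hσ
  have hσ0 : 0 < σ := ENNReal.toReal_pos h0 hZf
  have hlt : psiOneNorm μ Z < ENNReal.ofReal (2 * σ) := by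
    rw [← ENNReal.ofReal_toReal hZf, ENNReal.ofReal_lt_ofReal_iff (by positivity)]
    linarith
  have hlt' : psiOneNorm μ (-Z) < ENNReal.ofReal (2 * σ) := by rwa [psiOneNorm_neg]
  obtain ⟨hc, hb⟩ := lintegral_psiOne_le_one hlt
  have hb' := (lintegral_psiOne_le_one hlt').2
  have h1 := measure_mean_ge_le hW hWμ hWi hZ hZi hc hb hτ hτ1
  have h2 := measure_mean_ge_le hW hWμ hWi hZ.neg hZi.neg hc hb' hτ hτ1
  have hneg : ∫ x, (-Z) x ∂μ = -∫ x, Z x ∂μ := integral_neg _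
  rw [hneg] at h2
  have hsub : {ω | |∫ x, Z x ∂μ| + 10 * σ * τ < |(n : ℝ)⁻¹ * ∑ j, Z (W j ω)|} ⊆
      {ω | n * ((∫ x, Z x ∂μ) + 5 * (2 * σ) * τ) ≤ ∑ j, Z (W j ω)} ∪
      {ω | n * (-(∫ x, Z x ∂μ) + 5 * (2 * σ) * τ) ≤ ∑ j, (-Z) (W j ω)} := by
    intro ω hω
    simp only [Set.mem_ofPred_eq, Set.mem_union, Pi.neg_apply, Finset.sum_neg_distrib] at hω ⊢
    set T := ∑ j, Z (W j ω)
    have hT : T = n * ((n : ℝ)⁻¹ * T) := by field_simp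
    rw [hT]
    rcases le_total 0 ((n : ℝ)⁻¹ * T) with h | h
    · left
      rw [abs_of_nonneg h] at hω
      refine mul_le_mul_of_nonneg_left ?_ hn0.le
      linarith [le_abs_self (∫ x, Z x ∂μ)]
    · right
      rw [abs_of_nonpos h] at hω
      rw [← mul_neg]
      refine mul_le_mul_of_nonneg_left ?_ hn0.le
      linarith [neg_abs_le (∫ x, Z x ∂μ)]
  calc _ ≤ _ := measure_mono hsub
    _ ≤ _ := measure_union_le _ _
    _ ≤ _ := add_le_add h1 h2
    _ = _ := by
        rw [← ENNReal.ofReal_add (Real.exp_pos _).le (Real.exp_pos _).le, two_mul]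

end Bernstein

/-! ### The deterministic part of the oracle inequalities -/

section Deterministic

variable {S : Type*} {N n : ℕ}

theorem mem_cone {J : Finset (Fin N)} {u : EuclideanSpace ℝ (Fin N)} :
    u ∈ cone J ↔ ∑ j ∈ Jᶜ, |u j| ≤ ∑ j ∈ J, |u j| :=
  Iff.rfl

theorem sub_mem_cone_supp {lam lamHat : EuclideanSpace ℝ (Fin N)}
    (hle : l1norm lamHat ≤ l1norm lam) : lamHat - lam ∈ cone (supp lam) := by
  unfold l1norm at hle
  rw [← Finset.sum_add_sum_compl (supp lam), ← Finset.sum_add_sum_compl (supp lam)] at hle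
  have h0 : ∀ j ∈ (supp lam)ᶜ, lam j = 0 := fun j hj => by simpa [supp] using hj
  have h1 : ∑ j ∈ (supp lam)ᶜ, |lam j| = 0 := Finset.sum_eq_zero fun j hj => by simp [h0 j hj]
  have h2 : ∑ j ∈ (supp lam)ᶜ, |(lamHat - lam) j| = ∑ j ∈ (supp lam)ᶜ, |lamHat j| :=
    Finset.sum_congr rfl fun j hj => by simp [h0 j hj]
  have h3 : ∑ j ∈ supp lam, |lam j| - ∑ j ∈ supp lam, |lamHat j| ≤
      ∑ j ∈ supp lam, |(lamHat - lam) j| := by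
    rw [← Finset.sum_sub_distrib]
    refine Finset.sum_le_sum fun j _ => ?_
    rw [PiLp.sub_apply, abs_sub_comm]
    exact abs_sub_abs_le_abs_sub _ _
  rw [mem_cone, h2]
  linarith

theorem cone_mono {J I : Finset (Fin N)} (h : J ⊆ I) : cone J ⊆ cone I := by
  intro u hu
  rw [mem_cone] at hu ⊢
  calc ∑ j ∈ Iᶜ, |u j| ≤ ∑ j ∈ Jᶜ, |u j| :=
        Finset.sum_le_sum_of_subset_of_nonneg (Finset.compl_subset_compl.2 h)
          fun _ _ _ => abs_nonneg _
    _ ≤ ∑ j ∈ J, |u j| := hu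
    _ ≤ ∑ j ∈ I, |u j| := Finset.sum_le_sum_of_subset_of_nonneg h fun _ _ _ => abs_nonneg _

theorem eq_zero_of_mem_cone_empty {u : EuclideanSpace ℝ (Fin N)} (hu : u ∈ cone ∅) : u = 0 := by
  rw [mem_cone, Finset.compl_empty, Finset.sum_empty] at hu
  have h := (Finset.sum_eq_zero_iff_of_nonneg fun j _ => abs_nonneg (u j)).1
    (le_antisymm hu (Finset.sum_nonneg fun j _ => abs_nonneg (u j)))
  ext j
  simpa using h j (Finset.mem_univ j)

theorem sparseHull_mono {d D : ℕ} (h : d ≤ D) : sparseHull N d ⊆ sparseHull N D :=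
  fun _ hu a r hr => hu a r fun J hJ => hr J (hJ.trans h)

theorem le_maxB (B : Finset (Fin N) → ℝ≥0) {J : Finset (Fin N)} {d : ℕ} (hJ : J.card ≤ d) :
    B J ≤ maxB B d :=
  Finset.le_sup (f := B) (by simpa using hJ)

theorem maxB_mono (B : Finset (Fin N) → ℝ≥0) {d D : ℕ} (h : d ≤ D) : maxB B d ≤ maxB B D :=
  Finset.sup_le fun _ hJ => le_maxB B ((Finset.mem_filter.1 hJ).2.trans h)

/-- Two feasible vectors: the empirical `L₂`-norm of their difference. -/
theorem sum_sq_lin_sub_le {h : Fin N → S → ℝ} {ε : ℝ} {x : Fin n → S} {y : Fin n → ℝ}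
    {v w : EuclideanSpace ℝ (Fin N)} (hv : v ∈ feasible h ε x y) (hw : w ∈ feasible h ε x y) :
    (n : ℝ)⁻¹ * ∑ j, lin h (v - w) (x j) ^ 2 ≤ 2 * ε * ∑ k, |(v - w) k| := by
  have h1 : ∀ k, |(n : ℝ)⁻¹ * ∑ j, lin h (v - w) (x j) * h k (x j)| ≤ 2 * ε := fun k => by
    have : (n : ℝ)⁻¹ * ∑ j, lin h (v - w) (x j) * h k (x j) =
        (n : ℝ)⁻¹ * ∑ j, (lin h v (x j) - y j) * h k (x j) -
          (n : ℝ)⁻¹ * ∑ j, (lin h w (x j) - y j) * h k (x j) := by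
      rw [← mul_sub, ← Finset.sum_sub_distrib, lin_sub]
      congr 1
      exact Finset.sum_congr rfl fun j _ => by rw [Pi.sub_apply]; ring
    rw [this]
    exact (abs_sub _ _).trans (by linarith [hv k, hw k])
  have h2 : (n : ℝ)⁻¹ * ∑ j, lin h (v - w) (x j) ^ 2 =
      ∑ k, (v - w) k * ((n : ℝ)⁻¹ * ∑ j, lin h (v - w) (x j) * h k (x j)) := by
    calc (n : ℝ)⁻¹ * ∑ j, lin h (v - w) (x j) ^ 2
        = (n : ℝ)⁻¹ * ∑ j, ∑ k, (v - w) k * (lin h (v - w) (x j) * h k (x j)) := by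
          congr 1
          refine Finset.sum_congr rfl fun j _ => ?_
          rw [sq]
          nth_rewrite 2 [lin]
          rw [Finset.mul_sum]
          exact Finset.sum_congr rfl fun k _ => by ring
      _ = _ := by
          rw [Finset.sum_comm, Finset.mul_sum]
          refine Finset.sum_congr rfl fun k _ => ?_
          rw [← Finset.mul_sum]
          ring
  rw [h2, Finset.mul_sum]
  refine Finset.sum_le_sum fun k _ => (le_abs_self _).trans ?_
  rw [abs_mul, mul_comm]
  exact mul_le_mul_of_nonneg_right (h1 k) (abs_nonneg _)

variable [MeasurableSpace S] {h : Fin N → S → ℝ} {Q : Measure S}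

theorem memLp_lin (hL : ∀ k, MemLp (h k) 2 Q) (u : EuclideanSpace ℝ (Fin N)) :
    MemLp (lin h u) 2 Q := by
  unfold lin
  exact memLp_finsetSum _ fun j _ => (hL j).const_mul _

theorem sqrt_sum_sq_le_betaTwo (hL : ∀ k, MemLp (h k) 2 Q) {J : Finset (Fin N)}
    (hβ : betaTwo h Q J ≠ ∞) {u : EuclideanSpace ℝ (Fin N)} (hu : u ∈ cone J) :
    √(∑ j ∈ J, u j ^ 2) ≤ (betaTwo h Q J).toReal * (eLpNorm (lin h u) 2 Q).toReal := by
  set F := (eLpNorm (lin h u) 2 Q).toReal with hF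
  have hFe : eLpNorm (lin h u) 2 Q = ENNReal.ofReal F :=
    (ENNReal.ofReal_toReal (memLp_lin hL u).eLpNorm_ne_top).symm
  have hF0 : 0 ≤ F := ENNReal.toReal_nonneg
  have key : ∀ y : ℝ≥0∞, betaTwo h Q J < y →
      ∃ β : ℝ≥0, (β : ℝ≥0∞) < y ∧ √(∑ j ∈ J, u j ^ 2) ≤ β * F := fun y hy => by
    unfold betaTwo at hy
    simp only [iInf_lt_iff] at hy
    obtain ⟨β, ⟨-, hb⟩, hlt⟩ := hy
    refine ⟨β, hlt, Real.sqrt_le_iff.2 ⟨by positivity, ?_⟩⟩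
    have h1 := hb u hu
    rw [hFe, ← ENNReal.ofReal_coe_nnreal, ← mul_pow, ← ENNReal.ofReal_mul β.coe_nonneg,
      ← ENNReal.ofReal_pow (by positivity), ENNReal.ofReal_le_ofReal_iff (by positivity)] at h1
    simpa only [sq_abs] using h1
  by_contra! hcon
  rcases hF0.eq_or_lt with h0 | h0
  · obtain ⟨β, -, hle⟩ := key ∞ hβ.lt_top
    rw [← h0, mul_zero] at hle hcon
    linarith
  · have hlt : betaTwo h Q J < ENNReal.ofReal (√(∑ j ∈ J, u j ^ 2) / F) := by
      rw [ENNReal.lt_ofReal_iff_toReal_lt hβ, lt_div_iff₀ h0]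
      exact hcon
    obtain ⟨β, hβl, hle⟩ := key _ hlt
    rw [← ENNReal.ofReal_coe_nnreal, ENNReal.ofReal_lt_ofReal_iff_of_nonneg β.coe_nonneg,
      lt_div_iff₀ h0] at hβl
    linarith

theorem betaTwo_le_maxBetaTwo {J : Finset (Fin N)} {d : ℕ} (hJ : J.card ≤ 2 * d) :
    betaTwo h Q J ≤ maxBetaTwo h Q d :=
  le_iSup₂ (f := fun (J : Finset (Fin N)) (_ : J.card ≤ 2 * d) => betaTwo h Q J) J hJ

theorem maxBetaTwo_mono {d D : ℕ} (hd : d ≤ D) : maxBetaTwo h Q d ≤ maxBetaTwo h Q D :=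
  iSup₂_le fun _ hJ => betaTwo_le_maxBetaTwo (hJ.trans (by omega))

/-- The basis vectors belong to the cones of the one-point sets, which bounds `β₂` from below. -/
theorem one_le_betaTwo_singleton (hL : ∀ k, MemLp (h k) 2 Q) (k : Fin N)
    (hβ : betaTwo h Q {k} ≠ ∞) :
    1 ≤ (betaTwo h Q {k}).toReal *
      (eLpNorm (lin h (EuclideanSpace.single k 1)) 2 Q).toReal := by
  have hc : EuclideanSpace.single k (1 : ℝ) ∈ cone ({k} : Finset (Fin N)) := by
    rw [mem_cone, Finset.sum_eq_zero fun j hj => by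
      have : j ≠ k := by simpa using hj
      simp [this]]
    exact Finset.sum_nonneg fun _ _ => abs_nonneg _
  simpa using sqrt_sum_sq_le_betaTwo hL hβ hc

theorem maxBetaTwo_ne_zero (hL : ∀ k, MemLp (h k) 2 Q) (k : Fin N) {d : ℕ} (hd : 1 ≤ d) :
    maxBetaTwo h Q d ≠ 0 := fun h0 => by
  have h1 : betaTwo h Q {k} = 0 := le_antisymm
    (h0 ▸ betaTwo_le_maxBetaTwo (by rw [Finset.card_singleton]; omega)) zero_le
  have h2 := one_le_betaTwo_singleton hL k (by simp [h1])
  rw [h1] at h2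
  norm_num at h2

theorem maxBetaTwo_eq_top_of_sparsePsiOne_eq_zero (hh : ∀ k, Measurable (h k))
    (hL : ∀ k, MemLp (h k) 2 Q) (k : Fin N) {d D : ℕ} (hd : 1 ≤ d) (hD : 1 ≤ D)
    (hσ : sparsePsiOne h Q D = 0) : maxBetaTwo h Q d = ∞ := by
  by_contra htop
  have hdim : dim (EuclideanSpace.single k (1 : ℝ)) ≤ D := by
    have : supp (EuclideanSpace.single k (1 : ℝ)) ⊆ {k} := fun j hj => by
      by_contra hne
      have hne' : j ≠ k := by simpa using hne
      simp [supp, hne'] at hj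
    refine (Finset.card_le_card this).trans ?_
    rwa [Finset.card_singleton]
  have h1 : psiOneNorm Q (lin h (EuclideanSpace.single k 1)) = 0 := by
    refine le_antisymm (hσ ▸ ?_) zero_le
    exact le_iSup₂ (f := fun (u : EuclideanSpace ℝ (Fin N)) (_ : ‖u‖ ≤ 1 ∧ dim u ≤ D) =>
      psiOneNorm Q (lin h u)) _ ⟨by simp, hdim⟩
  have h2 := ae_eq_zero_of_psiOneNorm_eq_zero (measurable_lin hh _) h1
  have h3 : betaTwo h Q {k} ≠ ∞ := ne_top_of_le_ne_top htop
    (betaTwo_le_maxBetaTwo (by rw [Finset.card_singleton]; omega))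
  have h4 := one_le_betaTwo_singleton hL k h3
  rw [eLpNorm_congr_ae h2] at h4
  norm_num at h4

/-- The oracle bounds hold for all samples in which the empirical `L₁`-norms do not fall below
`‖f_u‖_{L₁(Q)}` by more than `κ` on the sparse hull. -/
theorem bounds_of_lower_deviation [IsProbabilityMeasure Q]
    (hL : ∀ k, MemLp (h k) 2 Q) {B : Finset (Fin N) → ℝ≥0} (hB : NormEquiv h Q B) (hn : 1 ≤ n)
    {ε : ℝ} (hε : 0 < ε) {x : Fin n → S} {y : Fin n → ℝ} {lam lamHat : EuclideanSpace ℝ (Fin N)}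
    (hlam : lam ∈ feasible h ε x y) (hHat : lamHat ∈ argminL1 (feasible h ε x y))
    (hd : 1 ≤ dim lam) (hβ : maxBetaTwo h Q (dim lam) ≠ ∞) {κ : ℝ} (hκ0 : 0 ≤ κ)
    (hdev : ∀ u ∈ sparseHull N (dim lam),
      ∑ j, ((∫ y, |lin h u y| ∂Q) - |lin h u (x j)|) ≤ n * κ)
    (hκ : maxB B (dim lam) * (maxBetaTwo h Q (dim lam)).toReal * (3 * κ) ≤ 1 / 2) :
    eLpNorm (lin h lamHat - lin h lam) 2 Q ≤ boundL2 h Q B ε (dim lam) ∧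
      ENNReal.ofReal ‖lamHat - lam‖ ≤ boundEll2 h Q B ε (dim lam) := by
  set d := dim lam with hd_def
  set J := supp lam
  have hJ : J.card ≤ d := le_rfl
  set u := lamHat - lam with hu_def
  have huc : u ∈ cone J := sub_mem_cone_supp (hHat.2 lam hlam)
  have hfin : eLpNorm (lin h u) 2 Q ≠ ∞ := (memLp_lin hL u).eLpNorm_ne_top
  have hLi : ∀ k, Integrable (h k) Q := fun k => (hL k).integrable one_le_two
  set F := (eLpNorm (lin h u) 2 Q).toReal with hF
  set b := (maxBetaTwo h Q d).toReal with hb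
  set B' : ℝ := (maxB B d : ℝ) with hB'
  set m := ∫ y, |lin h u y| ∂Q with hm
  have hF0 : 0 ≤ F := ENNReal.toReal_nonneg
  have hb0 : 0 ≤ b := ENNReal.toReal_nonneg
  have hB0 : 0 ≤ B' := NNReal.coe_nonneg _
  have hm0 : 0 ≤ m := integral_nonneg fun _ => abs_nonneg _
  have hn0 : (0 : ℝ) < n := by exact_mod_cast hn
  have hme : (eLpNorm (lin h u) 1 Q).toReal = m := by
    rw [eLpNorm_one_eq_lintegral_enorm, hm]
    exact (integral_norm_eq_lintegral_enorm (integrable_lin hLi u).aestronglyMeasurable).symm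
  have hFm : F ≤ B' * m := by
    have h1 := ((hB J).2 u huc).2
    have h2 : eLpNorm (lin h u) 1 Q ≠ ∞ :=
      (memLp_one_iff_integrable.2 (integrable_lin hLi u)).eLpNorm_ne_top
    have h3 := ENNReal.toReal_mono (ENNReal.mul_ne_top ENNReal.coe_ne_top h2) h1
    rw [ENNReal.toReal_mul, hme, ENNReal.coe_toReal] at h3
    refine h3.trans (mul_le_mul_of_nonneg_right ?_ hm0)
    exact_mod_cast le_maxB B hJ
  obtain ⟨I, hJI, hIc, hnorm, hgauge⟩ := exists_superset_of_mem_cone hd hJ huc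
  set q := √(∑ j ∈ I, u j ^ 2) with hq
  have hq0 : 0 ≤ q := Real.sqrt_nonneg _
  have hβI : betaTwo h Q I ≤ maxBetaTwo h Q d := betaTwo_le_maxBetaTwo hIc
  have hqF : q ≤ b * F :=
    (sqrt_sum_sq_le_betaTwo hL (ne_top_of_le_ne_top hβ hβI) (cone_mono hJI huc)).trans
      (mul_le_mul_of_nonneg_right (ENNReal.toReal_mono hβ hβI) hF0)
  set E := (n : ℝ)⁻¹ * ∑ j, |lin h u (x j)| with hE
  have hE0 : 0 ≤ E := mul_nonneg (by positivity) (Finset.sum_nonneg fun _ _ => abs_nonneg _)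
  -- the deviation bound, by homogeneity
  have hmE : m ≤ E + κ * (3 * q) := by
    rcases hq0.eq_or_lt with h0 | h0
    · have hu0 : u = 0 := by
        rw [← h0, mul_zero] at hnorm
        exact norm_le_zero_iff.1 hnorm
      have : m = 0 := by rw [hm, hu0]; simp [lin]
      rw [this]
      positivity
    · have hmem : (3 * q)⁻¹ • u ∈ sparseHull N d := fun a r hr => by
        have h1 := hgauge a r hr
        have h2 : ∑ k, ((3 * q)⁻¹ • u) k * a k = (3 * q)⁻¹ * ∑ k, u k * a k := by
          rw [Finset.mul_sum]
          exact Finset.sum_congr rfl fun k _ => by simp [mul_assoc]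
        rw [h2, inv_mul_le_iff₀ (by positivity)]
        linarith
      have h1 := hdev _ hmem
      have hpos : 0 < (3 * q)⁻¹ := by positivity
      simp only [lin_smul, abs_mul, abs_of_pos hpos] at h1
      rw [integral_const_mul] at h1
      simp only [← mul_sub] at h1
      rw [← Finset.mul_sum, inv_mul_le_iff₀ (by positivity), Finset.sum_sub_distrib] at h1
      simp only [Finset.sum_const, Finset.card_univ, Fintype.card_fin, nsmul_eq_mul] at h1
      rw [← hm] at h1
      have h2 : ∑ j, |lin h u (x j)| = n * E := by rw [hE]; field_simp
      rw [h2] at h1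
      refine le_of_mul_le_mul_left ?_ hn0
      linarith
  have hl1 : ∑ k, |u k| ≤ 2 * (√d * q) := by
    rw [← Finset.sum_add_sum_compl J]
    have h1 := sum_abs_le_sqrt_mul J hJ u
    have h2 : ∑ j ∈ Jᶜ, |u j| ≤ ∑ j ∈ J, |u j| := huc
    have h3 : √(∑ j ∈ J, u j ^ 2) ≤ q :=
      Real.sqrt_le_sqrt (Finset.sum_le_sum_of_subset_of_nonneg hJI fun _ _ _ => sq_nonneg _)
    have h4 := mul_le_mul_of_nonneg_left h3 (Real.sqrt_nonneg (d : ℝ))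
    linarith
  have hE2 : E ^ 2 ≤ 4 * ε * √d * (b * F) := by
    have h1 : E ^ 2 ≤ (n : ℝ)⁻¹ * ∑ j, lin h u (x j) ^ 2 := by
      have h2 := sq_sum_le_card_mul_sum_sq (s := Finset.univ) (f := fun j => |lin h u (x j)|)
      simp only [sq_abs, Finset.card_univ, Fintype.card_fin] at h2
      rw [hE, mul_pow]
      calc _ ≤ (n : ℝ)⁻¹ ^ 2 * (n * ∑ j, lin h u (x j) ^ 2) := by gcongr
        _ = _ := by field_simp
    have h2 := sum_sq_lin_sub_le hHat.1 hlam
    rw [← hu_def] at h2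
    calc E ^ 2 ≤ 2 * ε * ∑ k, |u k| := h1.trans h2
      _ ≤ 2 * ε * (2 * (√d * (b * F))) := by gcongr; exact hl1.trans (by gcongr)
      _ = _ := by ring
  have hFE : F ≤ 2 * B' * E := by
    have h1 : B' * (κ * (3 * q)) ≤ 1 / 2 * F := by
      calc B' * (κ * (3 * q)) ≤ B' * (κ * (3 * (b * F))) := by gcongr
        _ = B' * b * (3 * κ) * F := by ring
        _ ≤ _ := mul_le_mul_of_nonneg_right hκ hF0
    have h2 := mul_le_mul_of_nonneg_left hmE hB0
    linarith
  have hFfin : F ≤ 16 * B' ^ 2 * b * √d * ε := by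
    rcases hF0.eq_or_lt with h0 | h0
    · rw [← h0]; positivity
    · refine le_of_mul_le_mul_right ?_ h0
      calc F * F ≤ (2 * B' * E) * (2 * B' * E) := by gcongr
        _ = 4 * B' ^ 2 * E ^ 2 := by ring
        _ ≤ 4 * B' ^ 2 * (4 * ε * √d * (b * F)) := by gcongr
        _ = _ := by ring
  have hbe : maxBetaTwo h Q d = ENNReal.ofReal b := (ENNReal.ofReal_toReal hβ).symm
  have hBe : (maxB B d : ℝ≥0∞) = ENNReal.ofReal B' := (ENNReal.ofReal_coe_nnreal).symm
  constructor
  · have : boundL2 h Q B ε d = ENNReal.ofReal (16 * B' ^ 2 * b * √d * ε) := by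
      unfold boundL2
      rw [hbe, hBe, ENNReal.ofReal_mul (by positivity), ENNReal.ofReal_mul (by positivity),
        ENNReal.ofReal_mul (by positivity), ENNReal.ofReal_mul (by positivity),
        ENNReal.ofReal_pow hB0, ENNReal.ofReal_ofNat]
    rw [this, ← lin_sub, ← hu_def, ← ENNReal.ofReal_toReal hfin]
    exact ENNReal.ofReal_le_ofReal hFfin
  · have : boundEll2 h Q B ε d = ENNReal.ofReal (32 * B' ^ 2 * b ^ 2 * √d * ε) := by
      unfold boundEll2
      rw [hbe, hBe, ENNReal.ofReal_mul (by positivity), ENNReal.ofReal_mul (by positivity),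
        ENNReal.ofReal_mul (by positivity), ENNReal.ofReal_mul (by positivity),
        ENNReal.ofReal_pow hB0, ENNReal.ofReal_pow hb0, ENNReal.ofReal_ofNat]
    rw [this]
    refine ENNReal.ofReal_le_ofReal ?_
    calc ‖u‖ ≤ 2 * (b * F) := hnorm.trans (by gcongr)
      _ ≤ 2 * (b * (16 * B' ^ 2 * b * √d * ε)) := by gcongr
      _ = _ := by ring

theorem bounds_of_dim_eq_zero {B : Finset (Fin N) → ℝ≥0} {ε : ℝ} {x : Fin n → S} {y : Fin n → ℝ}
    {lam lamHat : EuclideanSpace ℝ (Fin N)} (hlam : lam ∈ feasible h ε x y)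
    (hHat : lamHat ∈ argminL1 (feasible h ε x y)) (hd : dim lam = 0) :
    eLpNorm (lin h lamHat - lin h lam) 2 Q ≤ boundL2 h Q B ε (dim lam) ∧
      ENNReal.ofReal ‖lamHat - lam‖ ≤ boundEll2 h Q B ε (dim lam) := by
  have huc : lamHat - lam ∈ cone (supp lam) := sub_mem_cone_supp (hHat.2 lam hlam)
  rw [Finset.card_eq_zero.1 hd] at huc
  have h0 := eq_zero_of_mem_cone_empty huc
  rw [sub_eq_zero.1 h0]
  simp

theorem bounds_eq_top {B : Finset (Fin N) → ℝ≥0} (hB : NormEquiv h Q B) {ε : ℝ} (hε : 0 < ε)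
    {d : ℕ} (hd : 1 ≤ d) (hβ : maxBetaTwo h Q d = ∞) :
    boundL2 h Q B ε d = ∞ ∧ boundEll2 h Q B ε d = ∞ := by
  have h1 : (maxB B d : ℝ≥0∞) ≠ 0 :=
    ENNReal.coe_ne_zero.2 (((hB ∅).1.trans_le (le_maxB B (by simp))).ne')
  have h2 : ENNReal.ofReal √(d : ℝ) ≠ 0 := by
    rw [ENNReal.ofReal_ne_zero_iff, Real.sqrt_pos]
    exact_mod_cast hd
  have h3 : ENNReal.ofReal ε ≠ 0 := by rwa [ENNReal.ofReal_ne_zero_iff]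
  unfold boundL2 boundEll2
  simp [hβ, ENNReal.mul_top, ENNReal.top_mul, h1, h2, h3]

end Deterministic

/-! ### The exceptional events -/

section Probability

variable {Ω : Type*} [MeasurableSpace Ω] {P : Measure Ω}

/-- The event `E` need not be measurable: its exceptional set is enlarged to a measurable one. -/
theorem holdsWithProb_of_measure_not_le [IsProbabilityMeasure P] {δ : ℝ} (hδ : 0 ≤ δ)
    {E : Ω → Prop} (h : P {ω | ¬ E ω} ≤ ENNReal.ofReal δ) : HoldsWithProb P (1 - δ) E := by
  refine ⟨(toMeasurable P {ω | ¬ E ω})ᶜ, (measurableSet_toMeasurable _ _).compl, ?_, ?_⟩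
  · rw [prob_compl_eq_one_sub (measurableSet_toMeasurable _ _), measure_toMeasurable,
      ENNReal.ofReal_sub _ hδ, ENNReal.ofReal_one]
    exact tsub_le_tsub_left h _
  · intro ω hω
    by_contra hn
    exact hω (subset_toMeasurable P _ hn)

/-- A bound that holds with the same probability for each element of a set holds for the infimum:
along a minimizing sequence the exceptional events increase. -/
theorem measure_not_le_iInf_le {ι : Type*} {T : Set ι} (hT : T.Nonempty) (a : ι → ℝ≥0∞)
    (f : Ω → ℝ≥0∞) {δ : ℝ≥0∞} (h : ∀ i ∈ T, P {ω | a i < f ω} ≤ δ) :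
    P {ω | ¬ f ω ≤ ⨅ i ∈ T, a i} ≤ δ := by
  obtain ⟨v, hanti, hlim, hmem⟩ := exists_seq_tendsto_sInf (hT.image a) (OrderBot.bddBelow _)
  rw [sInf_image] at hlim
  have hsub : {ω | ¬ f ω ≤ ⨅ i ∈ T, a i} ⊆ ⋃ k, {ω | v k < f ω} := fun ω hω => by
    obtain ⟨k, hk⟩ := (hlim.eventually_lt_const (not_le.1 hω)).exists
    exact Set.mem_iUnion.2 ⟨k, hk⟩
  have hmono : Monotone fun k => {ω | v k < f ω} := fun k l hkl ω hω =>
    (hanti hkl).trans_lt hω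
  refine (measure_mono hsub).trans ?_
  rw [hmono.measure_iUnion]
  refine iSup_le fun k => ?_
  obtain ⟨i, hi, hk⟩ := hmem k
  simp only [← hk]
  exact h i hi

end Probability

section Events

variable {Ω S : Type*} [MeasurableSpace Ω] [MeasurableSpace S] {P : Measure Ω} {Q : Measure S}
  {N n : ℕ} {h : Fin N → S → ℝ}

/-- The bounds relative to all sparse feasible vectors, with the exceptional probability
`5^{-DA} (N choose ≤ D)^{-A}`. -/
theorem measure_not_bounds_le [IsProbabilityMeasure P] [IsProbabilityMeasure Q] (hN : 2 ≤ N)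
    (hn : 1 ≤ n) (hh : ∀ k, Measurable (h k)) (hL : ∀ k, MemLp (h k) 2 Q)
    {X : Fin n → Ω → S} (hX : ∀ j, Measurable (X j)) (hXQ : ∀ j, P.map (X j) = Q)
    (hXi : iIndepFun X P) (Y : Fin n → Ω → ℝ) {B : Finset (Fin N) → ℝ≥0} (hB : NormEquiv h Q B)
    {ε A : ℝ} (hε : 0 < ε) (hA : 1 ≤ A) {D : ℕ} (hD1 : 1 ≤ D) (hD : D ∈ admissible h Q B n 216 A)
    {lamHat : Ω → EuclideanSpace ℝ (Fin N)}
    (hHat : ∀ ω, (feasible h ε (X · ω) (Y · ω)).Nonempty →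
      lamHat ω ∈ argminL1 (feasible h ε (X · ω) (Y · ω))) :
    P {ω | ¬ ∀ lam ∈ feasible h ε (X · ω) (Y · ω), dim lam ≤ D →
        eLpNorm (lin h (lamHat ω) - lin h lam) 2 Q ≤ boundL2 h Q B ε (dim lam) ∧
          ENNReal.ofReal ‖lamHat ω - lam‖ ≤ boundEll2 h Q B ε (dim lam)} ≤
      ENNReal.ofReal ((5 : ℝ) ^ (-(D * A)) * (chooseLE N D : ℝ) ^ (-A)) := by
  obtain ⟨hDe, hD2, hD3⟩ := hD
  have hLi : ∀ k, Integrable (h k) Q := fun k => (hL k).integrable one_le_two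
  have hD0 : (1 : ℝ) ≤ D := by exact_mod_cast hD1
  have hn0 : (0 : ℝ) < n := by exact_mod_cast hn
  have k₀ : Fin N := ⟨0, by omega⟩
  have hDN' : (D : ℝ) * Real.exp 1 ≤ N := by
    rw [← le_div_iff₀ (Real.exp_pos 1)]; linarith
  have hDN : D ≤ N := by
    have h1 : (D : ℝ) ≤ N := by nlinarith [Real.add_one_le_exp (1 : ℝ)]
    exact_mod_cast h1
  have hLog : 1 ≤ Real.log (N / D) := by
    rw [Real.le_log_iff_exp_le (by positivity), le_div_iff₀ (by linarith), mul_comm]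
    exact hDN'
  set L := Real.log (N / D)
  set τ := √(A * D * L / n) with hτ
  have harg : 0 < A * D * L / n := by positivity
  have hτ0 : 0 < τ := Real.sqrt_pos.2 harg
  have hτ1 : τ ≤ 1 := Real.sqrt_le_one.2 hD2
  have hτ2 : n * τ ^ 2 = A * D * L := by
    rw [hτ, Real.sq_sqrt harg.le]; field_simp
  have hmaxB : (maxB B D : ℝ≥0∞) ≠ 0 :=
    ENNReal.coe_ne_zero.2 (((hB ∅).1.trans_le (le_maxB B (by simp))).ne')
  have hτe : ENNReal.ofReal τ ≠ 0 := by rwa [ENNReal.ofReal_ne_zero_iff]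
  -- a degenerate dictionary makes the bounds trivial
  rcases eq_or_ne (sparsePsiOne h Q D) 0 with hσ | hσ
  · refine le_of_eq_of_le ?_ zero_le
    convert measure_empty (μ := P)
    refine Set.eq_empty_iff_forall_notMem.2 fun ω hω => hω fun lam hlam _ => ?_
    rcases Nat.eq_zero_or_pos (dim lam) with h0 | h0
    · exact bounds_of_dim_eq_zero hlam (hHat ω ⟨lam, hlam⟩) h0
    · obtain ⟨h1, h2⟩ := bounds_eq_top (d := dim lam) hB hε h0
        (maxBetaTwo_eq_top_of_sparsePsiOne_eq_zero hh hL k₀ h0 hD1 hσ)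
      rw [h1, h2]
      exact ⟨le_top, le_top⟩
  have hβ0 := maxBetaTwo_ne_zero hL k₀ hD1
  have h216 : ENNReal.ofReal 216 ≠ 0 := by norm_num
  have hfin : ENNReal.ofReal 216 * maxB B D * maxBetaTwo h Q D * sparsePsiOne h Q D *
      ENNReal.ofReal τ ≠ ∞ := ne_top_of_le_ne_top (by simp) hD3
  have hβ : maxBetaTwo h Q D ≠ ∞ := fun htop => hfin (by
    simp [htop, ENNReal.mul_top, ENNReal.top_mul, hσ, hτe, hmaxB])
  have hσt : sparsePsiOne h Q D ≠ ∞ := fun htop => hfin (by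
    simp [htop, ENNReal.mul_top, ENNReal.top_mul, hβ0, hτe, hmaxB])
  set σ := (sparsePsiOne h Q D).toReal with hσ_def
  have hσ0 : 0 < σ := ENNReal.toReal_pos hσ hσt
  have hreal : 216 * (maxB B D : ℝ) * (maxBetaTwo h Q D).toReal * σ * τ ≤ 1 / 4 := by
    have h1 := ENNReal.toReal_mono (by simp) hD3
    simpa [ENNReal.toReal_mul, ENNReal.toReal_ofReal hτ0.le] using h1
  have hb : ∀ v : EuclideanSpace ℝ (Fin N), ‖v‖ ≤ 1 → dim v ≤ D →
      ∫⁻ x, ENNReal.ofReal (psiOne (|lin h v x| / (2 * σ))) ∂Q ≤ 1 := fun v hv hdv => by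
    refine (lintegral_psiOne_le_one (lt_of_le_of_lt (b := sparsePsiOne h Q D) ?_ ?_)).2
    · exact le_iSup₂ (f := fun (u : EuclideanSpace ℝ (Fin N)) (_ : ‖u‖ ≤ 1 ∧ dim u ≤ D) =>
        psiOneNorm Q (lin h u)) v ⟨hv, hdv⟩
    · rw [← ENNReal.ofReal_toReal hσt, ENNReal.ofReal_lt_ofReal_iff (by positivity)]
      linarith
  have hmain := measure_exists_sparseHull_le hh hLi n D (by positivity : 0 < 2 * σ) hτ0.le hτ1 hb
  rw [hτ2] at hmain
  have hpi := (iIndepFun_iff_map_fun_eq_pi_map fun j => (hX j).aemeasurable).1 hXi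
  simp only [hXQ] at hpi
  rw [← hpi] at hmain
  refine le_trans ?_ (hmain.trans (ENNReal.ofReal_le_ofReal (net_card_mul_exp_le hD1 hDN hLog hA)))
  refine le_trans (measure_mono fun ω hω => ?_)
    (Measure.le_map_apply (measurable_pi_lambda _ hX).aemeasurable _)
  by_contra hgood
  simp only [Set.mem_preimage, Set.mem_ofPred_eq, not_exists, not_and, not_lt] at hgood
  refine hω fun lam hlam hdim => ?_
  rcases Nat.eq_zero_or_pos (dim lam) with h0 | h0
  · exact bounds_of_dim_eq_zero hlam (hHat ω ⟨lam, hlam⟩) h0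
  have hββ := maxBetaTwo_mono (h := h) (Q := Q) hdim
  refine bounds_of_lower_deviation hL hB hn hε hlam (hHat ω ⟨lam, hlam⟩) h0
    (ne_top_of_le_ne_top hβ hββ) (κ := 36 * (2 * σ) * τ) (by positivity)
    (fun u hu => hgood u (sparseHull_mono hdim hu)) ?_
  have hBB : (maxB B (dim lam) : ℝ) ≤ maxB B D := by exact_mod_cast maxB_mono B hdim
  -- `216 = 3 · 36 · 2`: gauge of the cone, deviation bound, and slack in the `ψ₁`-norm
  calc (maxB B (dim lam) : ℝ) * (maxBetaTwo h Q (dim lam)).toReal * (3 * (36 * (2 * σ) * τ))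
      ≤ maxB B D * (maxBetaTwo h Q D).toReal * (3 * (36 * (2 * σ) * τ)) := by
        gcongr
    _ = 216 * (maxB B D : ℝ) * (maxBetaTwo h Q D).toReal * σ * τ := by ring
    _ ≤ 1 / 2 := by linarith

theorem psiOneNorm_comp_fst [SFinite Q] (ν : Measure ℝ) [IsProbabilityMeasure ν] {U : S → ℝ}
    (hU : Measurable U) : psiOneNorm (Q.prod ν) (fun p => U p.1) = psiOneNorm Q U := by
  unfold psiOneNorm orliczNorm
  refine iInf_congr fun c => ?_
  have hm : Measurable fun x => ENNReal.ofReal (psiOne (|U x| / c)) :=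
    (measurable_psiOne.comp (by fun_prop)).ennreal_ofReal
  have : ∫⁻ p, ENNReal.ofReal (psiOne (|U p.1| / c)) ∂(Q.prod ν) =
      ∫⁻ x, ENNReal.ofReal (psiOne (|U x| / c)) ∂Q := by
    have hm' : Measurable fun p : S × ℝ => ENNReal.ofReal (psiOne (|U p.1| / c)) :=
      hm.comp measurable_fst
    rw [lintegral_prod _ hm'.aemeasurable]
    simp
  rw [this]

/-- A vector that approximates `fstar` well satisfies the constraints of the Dantzig selector with
large probability. -/
theorem measure_not_feasible_le [IsProbabilityMeasure P] [IsProbabilityMeasure Q] (hN : 2 ≤ N)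
    (hn : 1 ≤ n) (hh : ∀ k, Measurable (h k)) {fstar : S → ℝ} (hf : Measurable fstar)
    {ν : Measure ℝ} [IsProbabilityMeasure ν]
    {X : Fin n → Ω → S} (hX : ∀ j, Measurable (X j)) (hXQ : ∀ j, P.map (X j) = Q)
    (hXi : iIndepFun X P) {ξ : Fin n → Ω → ℝ} (hξ : ∀ j, Measurable (ξ j))
    (hξν : ∀ j, P.map (ξ j) = ν) (hξi : iIndepFun ξ P) (hν : ∫ t, t ∂ν = 0)
    (hind : IndepFun (fun ω j => X j ω) (fun ω j => ξ j ω) P)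
    {Y : Fin n → Ω → ℝ} (hY : ∀ j ω, Y j ω = fstar (X j ω) + ξ j ω)
    {C ε A : ℝ} (hC : 10 ≤ C) (hε : 0 < ε) (hA : 1 ≤ A) (hAn : A * Real.log N / n ≤ 1)
    {lam : EuclideanSpace ℝ (Fin N)} (hlam : lam ∈ approxSet h fstar Q ν n C A ε) :
    P {ω | lam ∉ feasible h ε (X · ω) (Y · ω)} ≤ ENNReal.ofReal ((N : ℝ) ^ (-A) / 2) := by
  have hn0 : (0 : ℝ) < n := by exact_mod_cast hn
  have hN2 : (2 : ℝ) ≤ N := by exact_mod_cast hN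
  have hlog : 0 < Real.log N := Real.log_pos (by linarith)
  set τ := √(A * Real.log N / n) with hτ
  have harg : 0 < A * Real.log N / n := by positivity
  have hτ0 : 0 < τ := Real.sqrt_pos.2 harg
  have hτ1 : τ ≤ 1 := Real.sqrt_le_one.2 hAn
  have hτ2 : n * τ ^ 2 = A * Real.log N := by
    rw [hτ, Real.sq_sqrt harg.le]; field_simp
  let W : Fin n → Ω → S × ℝ := fun j ω => (X j ω, ξ j ω)
  have hW : ∀ j, Measurable (W j) := fun j => (hX j).prodMk (hξ j)
  have hWi : iIndepFun W P := iIndepFun_prodMk hX hξ hXi hξi hind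
  have hWμ : ∀ j, P.map (W j) = Q.prod ν := fun j => by
    rw [← hXQ j, ← hξν j]
    exact (indepFun_iff_map_prod_eq_prod_map_map (hX j).aemeasurable (hξ j).aemeasurable).1
      (hind.comp (measurable_pi_apply j) (measurable_pi_apply j))
  let U : Fin N → S → ℝ := fun k x => (lin h lam x - fstar x) * h k x
  let R : Fin N → S × ℝ → ℝ := fun k p => p.2 * h k p.1
  let Z : Fin N → S × ℝ → ℝ := fun k => (fun p => U k p.1) + -R k
  have hU : ∀ k, Measurable (U k) := fun k => ((measurable_lin hh lam).sub hf).mul (hh k)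
  have hU' : ∀ k, Measurable fun p : S × ℝ => U k p.1 := fun k => (hU k).comp measurable_fst
  have hR : ∀ k, Measurable (R k) := fun k => measurable_snd.mul ((hh k).comp measurable_fst)
  have hZ : ∀ k, Measurable (Z k) := fun k => (hU' k).add (hR k).neg
  have hk : ∀ k, P {ω | ε < |(n : ℝ)⁻¹ * ∑ j, Z k (W j ω)|} ≤
      ENNReal.ofReal (2 * Real.exp (-(4 * (A * Real.log N)))) := fun k => by
    have hap := hlam k
    have hτe : ENNReal.ofReal τ ≠ 0 := by rwa [ENNReal.ofReal_ne_zero_iff]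
    have hCe : ENNReal.ofReal C ≠ 0 := by rw [ENNReal.ofReal_ne_zero_iff]; linarith
    have hC0 : 0 ≤ C := by linarith
    set p := psiOneNorm Q (U k) + psiOneNorm (Q.prod ν) (R k) with hp
    change ENNReal.ofReal |∫ x, U k x ∂Q| + ENNReal.ofReal C * p * ENNReal.ofReal τ ≤ _ at hap
    have hpt : p ≠ ∞ := fun htop => by
      rw [htop, ENNReal.mul_top hCe, ENNReal.top_mul hτe, add_top, top_le_iff] at hap
      exact ENNReal.ofReal_ne_top hap
    have hZp : psiOneNorm (Q.prod ν) (Z k) ≤ p := by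
      refine (psiOneNorm_add_le (hU' k)).trans_eq ?_
      rw [psiOneNorm_neg, psiOneNorm_comp_fst ν (hU k)]
    have hZt := ne_top_of_le_ne_top hpt hZp
    have hreal : |∫ x, U k x ∂Q| + C * p.toReal * τ ≤ ε := by
      rw [← ENNReal.ofReal_toReal hpt, ← ENNReal.ofReal_mul hC0,
        ← ENNReal.ofReal_mul (by positivity), ← ENNReal.ofReal_add (abs_nonneg _) (by positivity),
        ENNReal.ofReal_le_ofReal_iff hε.le] at hap
      exact hap
    -- the noise is centered and independent of the design
    have hmean : ∫ q, Z k q ∂(Q.prod ν) = ∫ x, U k x ∂Q := by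
      have hUi : Integrable (fun p : S × ℝ => U k p.1) (Q.prod ν) := by
        refine integrable_of_psiOneNorm_ne_top (hU' k) (ne_top_of_le_ne_top hpt ?_)
        rw [psiOneNorm_comp_fst ν (hU k)]
        exact le_self_add
      have hRi : Integrable (R k) (Q.prod ν) :=
        integrable_of_psiOneNorm_ne_top (hR k) (ne_top_of_le_ne_top hpt le_add_self)
      have h1 : ∫ q, R k q ∂(Q.prod ν) = 0 := by
        have : ∫ q, R k q ∂(Q.prod ν) = ∫ q : S × ℝ, h k q.1 * q.2 ∂(Q.prod ν) :=
          integral_congr_ae (Filter.Eventually.of_forall fun q => mul_comm _ _)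
        rw [this, integral_prod_mul (h k) fun t : ℝ => t, hν, mul_zero]
      have h2 : ∫ q, Z k q ∂(Q.prod ν) =
          ∫ q, U k q.1 ∂(Q.prod ν) + ∫ q, (-R k) q ∂(Q.prod ν) := integral_add hUi hRi.neg
      rw [h2, integral_neg' (R k), h1, neg_zero, add_zero]
      rw [integral_prod _ hUi]
      simp
    have hmain := measure_abs_mean_gt_le hn hW hWμ hWi (hZ k) hZt hτ0.le hτ1
    rw [hτ2, hmean] at hmain
    refine (measure_mono fun ω hω => ?_).trans hmain
    rw [Set.mem_ofPred_eq] at hω ⊢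
    refine lt_of_le_of_lt (le_trans ?_ hreal) hω
    have h3 : (psiOneNorm (Q.prod ν) (Z k)).toReal ≤ p.toReal := ENNReal.toReal_mono hpt hZp
    gcongr
  have hsub : {ω | lam ∉ feasible h ε (X · ω) (Y · ω)} ⊆
      ⋃ k, {ω | ε < |(n : ℝ)⁻¹ * ∑ j, Z k (W j ω)|} := fun ω hω => by
    simp only [feasible, Set.mem_ofPred_eq, not_forall, not_le] at hω
    obtain ⟨k, hlt⟩ := hω
    refine Set.mem_iUnion.2 ⟨k, ?_⟩
    have hsum : ∑ j, Z k (W j ω) = ∑ j, (lin h lam (X j ω) - Y j ω) * h k (X j ω) :=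
      Finset.sum_congr rfl fun j _ => by
        simp only [Z, U, R, W, Pi.add_apply, Pi.neg_apply, hY]
        ring
    rw [Set.mem_ofPred_eq, hsum]
    exact hlt
  have hnum : (N : ℝ) * (2 * Real.exp (-(4 * (A * Real.log N)))) ≤ (N : ℝ) ^ (-A) / 2 := by
    have hN0 : (0 : ℝ) < N := by linarith
    have h1 : Real.exp (-(4 * (A * Real.log N))) = (N : ℝ) ^ (-A) * (N : ℝ) ^ (-(3 * A)) := by
      rw [← Real.rpow_add hN0, Real.rpow_def_of_pos hN0]; ring_nf
    have h2 : (N : ℝ) ^ (-(3 * A)) ≤ (N : ℝ) ^ (-3 : ℝ) :=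
      Real.rpow_le_rpow_of_exponent_le (by linarith) (by linarith)
    have h3 : (N : ℝ) ^ (-3 : ℝ) = ((N : ℝ) ^ 3)⁻¹ := by
      rw [Real.rpow_neg hN0.le]; norm_cast
    have h4 : 4 * N * (N : ℝ) ^ (-(3 * A)) ≤ 1 := by
      calc 4 * N * (N : ℝ) ^ (-(3 * A)) ≤ 4 * N * ((N : ℝ) ^ 3)⁻¹ := by
            rw [← h3]; gcongr
        _ ≤ 1 := by
            rw [← div_eq_mul_inv, div_le_one (by positivity)]
            nlinarith [mul_self_nonneg ((N : ℝ) - 2)]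
    have h5 : 0 < (N : ℝ) ^ (-A) := Real.rpow_pos_of_pos hN0 _
    rw [h1]
    nlinarith
  calc _ ≤ _ := measure_mono hsub
    _ ≤ ∑ k, P {ω | ε < |(n : ℝ)⁻¹ * ∑ j, Z k (W j ω)|} := measure_iUnion_fintype_le _ _
    _ ≤ ∑ _k : Fin N, ENNReal.ofReal (2 * Real.exp (-(4 * (A * Real.log N)))) :=
        Finset.sum_le_sum fun k _ => hk k
    _ = ENNReal.ofReal (N * (2 * Real.exp (-(4 * (A * Real.log N))))) := by
        rw [Finset.sum_const, Finset.card_univ, Fintype.card_fin, nsmul_eq_mul,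
          ENNReal.ofReal_mul (by positivity : (0 : ℝ) ≤ N), ENNReal.ofReal_natCast]
    _ ≤ _ := ENNReal.ofReal_le_ofReal hnum

end Events

end Dantzig

/-! ### The oracle inequalities -/

theorem theorem2 :
    ∃ C : ℝ, 0 < C ∧
      ∀ {Ω : Type*} [MeasurableSpace Ω] (P : Measure Ω) [IsProbabilityMeasure P]
        {S : Type*} [MeasurableSpace S] (Q : Measure S) (ν : Measure ℝ)
        (N n : ℕ) (_ : 2 ≤ N) (_ : 1 ≤ n)
        -- the dictionary and the regression function
        (h : Fin N → S → ℝ) (_ : ∀ k, Measurable (h k)) (_ : ∀ k, MemLp (h k) 2 Q)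
        (fstar : S → ℝ) (_ : Measurable fstar)
        -- the design points are i.i.d. with distribution `Q`
        (X : Fin n → Ω → S) (_ : ∀ j, Measurable (X j)) (_ : ∀ j, P.map (X j) = Q)
        (_ : iIndepFun X P)
        -- the noise is i.i.d. with distribution `ν`, centered, and independent of the design
        (ξ : Fin n → Ω → ℝ) (_ : ∀ j, Measurable (ξ j)) (_ : ∀ j, P.map (ξ j) = ν)
        (_ : iIndepFun ξ P) (_ : Integrable (fun t : ℝ => t) ν) (_ : ∫ t, t ∂ν = 0)
        (_ : IndepFun (fun ω j => X j ω) (fun ω j => ξ j ω) P)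
        -- the responses
        (Y : Fin n → Ω → ℝ) (_ : ∀ j ω, Y j ω = fstar (X j ω) + ξ j ω)
        -- the norm equivalence on the cones
        (B : Finset (Fin N) → ℝ≥0) (_ : Dantzig.NormEquiv h Q B)
        (ε A : ℝ) (_ : 0 < ε) (_ : 1 ≤ A) (_ : A * Real.log N / n ≤ 1)
        (dbar : ℕ) (_ : IsGreatest (Dantzig.admissible h Q B n C A) dbar)
        -- the Dantzig selector, arbitrary where the set of constraints is empty
        (lamHat : Ω → EuclideanSpace ℝ (Fin N))
        (_ : ∀ ω, (Dantzig.feasible h ε (X · ω) (Y · ω)).Nonempty →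
          lamHat ω ∈ Dantzig.argminL1 (Dantzig.feasible h ε (X · ω) (Y · ω))),
        Dantzig.HoldsWithProb P
          (1 - (5 : ℝ) ^ (-(dbar * A)) * (Dantzig.chooseLE N dbar : ℝ) ^ (-A))
          (fun ω => ∀ lam ∈ Dantzig.feasible h ε (X · ω) (Y · ω), Dantzig.dim lam ≤ dbar →
            eLpNorm (Dantzig.lin h (lamHat ω) - Dantzig.lin h lam) 2 Q ≤
                Dantzig.boundL2 h Q B ε (Dantzig.dim lam) ∧
              ENNReal.ofReal ‖lamHat ω - lam‖ ≤
                Dantzig.boundEll2 h Q B ε (Dantzig.dim lam)) ∧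
        ((Dantzig.oracleSet h fstar Q ν n C A ε dbar).Nonempty →
          Dantzig.HoldsWithProb P (1 - (N : ℝ) ^ (-A))
            (fun ω => eLpNorm (Dantzig.lin h (lamHat ω) - fstar) 2 Q ≤
              ⨅ lam ∈ Dantzig.oracleSet h fstar Q ν n C A ε dbar,
                (eLpNorm (Dantzig.lin h lam - fstar) 2 Q +
                  Dantzig.boundL2 h Q B ε (Dantzig.dim lam))) ∧
          ∀ lamStar : EuclideanSpace ℝ (Fin N), fstar =ᵐ[Q] Dantzig.lin h lamStar →
            Dantzig.HoldsWithProb P (1 - (N : ℝ) ^ (-A))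
              (fun ω => ENNReal.ofReal ‖lamHat ω - lamStar‖ ≤
                ⨅ lam ∈ Dantzig.oracleSet h fstar Q ν n C A ε dbar,
                  (ENNReal.ofReal ‖lam - lamStar‖ +
                    Dantzig.boundEll2 h Q B ε (Dantzig.dim lam)))) := by
  refine ⟨216, by norm_num, ?_⟩
  intro Ω _ P _ S _ Q ν N n hN hn h hh hL fstar hf X hX hXQ hXi ξ hξ hξν hξi _ hν hind Y hY B hB
    ε A hε hA hAn D hD lamHat hHat
  have : IsProbabilityMeasure Q := by
    rw [← hXQ ⟨0, hn⟩]; exact Measure.isProbabilityMeasure_map (hX _).aemeasurable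
  have : IsProbabilityMeasure ν := by
    rw [← hξν ⟨0, hn⟩]; exact Measure.isProbabilityMeasure_map (hξ _).aemeasurable
  have hN0 : (0 : ℝ) < N := by exact_mod_cast (by omega : 0 < N)
  have hNA : 0 < (N : ℝ) ^ (-A) := Real.rpow_pos_of_pos hN0 _
  set E : Ω → Prop := fun ω => ∀ lam ∈ Dantzig.feasible h ε (X · ω) (Y · ω), Dantzig.dim lam ≤ D →
    eLpNorm (Dantzig.lin h (lamHat ω) - Dantzig.lin h lam) 2 Q ≤
        Dantzig.boundL2 h Q B ε (Dantzig.dim lam) ∧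
      ENNReal.ofReal ‖lamHat ω - lam‖ ≤ Dantzig.boundEll2 h Q B ε (Dantzig.dim lam) with hE
  -- for `D = 0` the bounds hold surely, although the guaranteed probability is `0`
  have hbounds : P {ω | ¬ E ω} ≤
        ENNReal.ofReal ((5 : ℝ) ^ (-(D * A)) * (Dantzig.chooseLE N D : ℝ) ^ (-A)) ∧
      P {ω | ¬ E ω} ≤ ENNReal.ofReal ((N : ℝ) ^ (-A) / 2) := by
    rcases Nat.eq_zero_or_pos D with h0 | h0
    · have hzero : P {ω | ¬ E ω} = 0 := by
        convert measure_empty (μ := P)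
        refine Set.eq_empty_iff_forall_notMem.2 fun ω hω => hω fun lam hlam hdim => ?_
        exact Dantzig.bounds_of_dim_eq_zero hlam (hHat ω ⟨lam, hlam⟩) (by omega)
      rw [hzero]
      exact ⟨zero_le, zero_le⟩
    · have h1 := Dantzig.measure_not_bounds_le hN hn hh hL hX hXQ hXi Y hB hε hA h0 hD.1 hHat
      refine ⟨h1, h1.trans (ENNReal.ofReal_le_ofReal ?_)⟩
      have hD1 : (1 : ℝ) ≤ D := by exact_mod_cast h0
      have h5 : (5 : ℝ) ^ (-(D * A)) ≤ 1 / 2 := by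
        calc (5 : ℝ) ^ (-(D * A)) ≤ (5 : ℝ) ^ (-1 : ℝ) :=
              Real.rpow_le_rpow_of_exponent_le (by norm_num) (by nlinarith)
          _ ≤ 1 / 2 := by rw [Real.rpow_neg_one]; norm_num
      have hM : (Dantzig.chooseLE N D : ℝ) ^ (-A) ≤ (N : ℝ) ^ (-A) :=
        Real.rpow_le_rpow_of_nonpos hN0 (by exact_mod_cast (Dantzig.lt_chooseLE h0).le)
          (by linarith)
      calc _ ≤ 1 / 2 * (N : ℝ) ^ (-A) := by gcongr
        _ = _ := by ring
  have hunion : ∀ lam ∈ Dantzig.oracleSet h fstar Q ν n 216 A ε D,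
      P ({ω | ¬ E ω} ∪ {ω | lam ∉ Dantzig.feasible h ε (X · ω) (Y · ω)}) ≤
        ENNReal.ofReal ((N : ℝ) ^ (-A)) := fun lam hlam => by
    have h2 := Dantzig.measure_not_feasible_le hN hn hh hf hX hXQ hXi hξ hξν hξi hν hind hY
      (by norm_num) hε hA hAn hlam.1
    refine (measure_union_le _ _).trans ((add_le_add hbounds.2 h2).trans_eq ?_)
    rw [← ENNReal.ofReal_add (by positivity) (by positivity), add_halves]
  refine ⟨Dantzig.holdsWithProb_of_measure_not_le (by positivity) hbounds.1, fun hne => ⟨?_, ?_⟩⟩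
  · refine Dantzig.holdsWithProb_of_measure_not_le hNA.le
      (Dantzig.measure_not_le_iInf_le hne _ _ fun lam hlam => ?_)
    refine (measure_mono fun ω hω => ?_).trans (hunion lam hlam)
    by_contra hcon
    simp only [Set.mem_union, Set.mem_ofPred_eq, not_or, not_not] at hcon
    rw [Set.mem_ofPred_eq] at hω
    refine absurd hω (not_lt.2 ?_)
    have h3 := (hcon.1 lam hcon.2 hlam.2).1
    have hm := Dantzig.measurable_lin hh
    calc eLpNorm (Dantzig.lin h (lamHat ω) - fstar) 2 Q
        = eLpNorm ((Dantzig.lin h lam - fstar) +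
            (Dantzig.lin h (lamHat ω) - Dantzig.lin h lam)) 2 Q := by
          congr 1; abel
      _ ≤ _ := eLpNorm_add_le ((hm lam).sub hf).aestronglyMeasurable
          ((hm _).sub (hm lam)).aestronglyMeasurable one_le_two
      _ ≤ _ := by gcongr
  · intro lamStar _
    refine Dantzig.holdsWithProb_of_measure_not_le hNA.le
      (Dantzig.measure_not_le_iInf_le hne _ _ fun lam hlam => ?_)
    refine (measure_mono fun ω hω => ?_).trans (hunion lam hlam)
    by_contra hcon
    simp only [Set.mem_union, Set.mem_ofPred_eq, not_or, not_not] at hcon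
    rw [Set.mem_ofPred_eq] at hω
    refine absurd hω (not_lt.2 ?_)
    have h3 := (hcon.1 lam hcon.2 hlam.2).2
    calc ENNReal.ofReal ‖lamHat ω - lamStar‖
        ≤ ENNReal.ofReal (‖lam - lamStar‖ + ‖lamHat ω - lam‖) := by
          refine ENNReal.ofReal_le_ofReal ?_
          rw [add_comm]
          exact norm_sub_le_norm_sub_add_norm_sub _ _ _
      _ = _ := ENNReal.ofReal_add (norm_nonneg _) (norm_nonneg _)
      _ ≤ _ := by gcongr
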